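/- **Setting.** Let $x=e^{i\theta}$ be the coordinate on the unit circle $S^1\subset\mathbb C$ and $\partial=d/dx$. Let $\Psi\mathrm{Dif}(S^1)$ be the associative algebra of formal pseudodifferential operators $A=\sum_{n\le M}a_n(x)\,\partial^n$ ($M\in\mathbb Z$, $a_n\in C^\infty(S^1;\mathbb C)$) with $$a\partial^m\cdot b\partial^n=\sum_{k\ge0}\binom mk\,a\,b^{(k)}\,\partial^{m+n-k}\qquad(m,n\in\mathbb Z),$$ regarded also as a complex Lie algebra with $[A,B]=A\cdot B-B\cdot A$. Let $\mathrm{Tr}\colon\Psi\mathrm{Dif}(S^1)\to\mathbb C$ be the noncommutative residue, $\mathrm{Tr}(A)=$ the coefficient of $x^{-1}\partial^{-1}$ in $A$, i.e. $\frac1{2\pi i}\oint a_{-1}\,dx$. Let $\mathrm{Dif}_1\subset\Psi\mathrm{Dif}(S^1)$ be the Lie algebra of polynomial differential operators (the associative subalgebra generated by $x$ and $\partial$, with the commutator bracket). Put $$D_1(a\partial^n)=[\ln\partial,a\partial^n]=\sum_{k\ge1}\frac{(-1)^{k-1}}k\,a^{(k)}\partial^{n-k},\qquad D_2(a\partial^n)=[\ln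 x,a\partial^n]=-\sum_{k\ge1}\binom nk\,a\,(x^{-1})^{(k-1)}\,\partial^{n-k},$$ extended to infinite sums, and $Q=\sum_{n\ge1}\frac{(n-1)!}{n}\,x^{-n}\partial^{-n}$. Let $$\Psi_3(A_1,A_2,A_3)=\sum_{\sigma\in S_3}\sum_{\tau\in S_2}\mathrm{sgn}(\sigma)\,\mathrm{sgn}(\tau)\,\mathrm{Tr}\bigl(D_{\tau(1)}A_{\sigma(1)}\cdot D_{\tau(2)}A_{\sigma(2)}\cdot A_{\sigma(3)}\bigr)+\sum_{\sigma\in S_3}\mathrm{sgn}(\sigma)\,\mathrm{Tr}\bigl(Q\cdot A_{\sigma(1)}\cdot A_{\sigma(2)}\cdot A_{\sigma(3)}\bigr).$$ Cochains are alternating $\mathbb C$-multilinear maps to the trivial module $\mathbb C$, with the Chevalley–Eilenberg differential; a cocycle is cohomologous to zero if it is the differential of a cochain. **Theorem 1.1.** $D_1$ and $D_2$ are derivations of the associative algebra $\Psi\mathrm{Dif}(S^1)$, and $[D_1,D_2]=\mathrm{ad}\,Q$. The form $\Psi_3$ is a $3$-cocycle on the Lie algebra $\Psi\mathrm{Dif}(S^1)$,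 and it is not cohomologous to zero. The chain $1\wedge x\wedge\partial$ is a cycle of $\mathrm{Dif}_1$ and $\Psi_3(1,x,\partial)\ne0$; the restriction of $\Psi_3$ to $\mathrm{Dif}_1$ is not cohomologous to zero. More generally, for every Lie algebra $\mathfrak g$ with $\mathrm{Dif}_1\subseteq\mathfrak g\subseteq\Psi\mathrm{Dif}(S^1)$ (for example, the operators with coefficients in $\mathbb C[x,x^{-1}]$) the restriction of $\Psi_3$ to $\mathfrak g$ is a cocycle that is not cohomologous to zero. -/

import Mathlib

noncomputable section

/-! ### Formal pseudodifferential operators over a commutative differential algebra -/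

section Symbols

variable {R : Type*} [CommRing R] [Algebra ℂ R]

/-- Coefficient sequences `n ↦ aₙ` (`n ∈ ℤ`) that vanish for all large `n`. -/
def boundedAbove (R : Type*) [CommRing R] [Algebra ℂ R] : Submodule ℂ (ℤ → R) where
  carrier := {a | ∃ M : ℤ, ∀ n, M < n → a n = 0}
  zero_mem' := ⟨0, fun _ _ => rfl⟩
  add_mem' := by
    rintro a b ⟨M, hM⟩ ⟨N, hN⟩
    refine ⟨max M N, fun n hn => ?_⟩
    simp [hM n (lt_of_le_of_lt (le_max_left _ _) hn), hN n (lt_of_le_of_lt (le_max_right _ _) hn)]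
  smul_mem' := by
    rintro c a ⟨M, hM⟩
    exact ⟨M, fun n hn => by simp [hM n hn]⟩

/-- The space of formal pseudodifferential operators `A = ∑_{n ≤ M} aₙ ∂ⁿ` with coefficients `aₙ`
in the commutative differential algebra `(R, δ)`; it is made into an associative algebra, with
`∂ ∘ a = a ∘ ∂ + δ a`, below. -/
def PsiDO (_δ : Derivation ℂ R R) : Type _ := boundedAbove R

variable (δ : Derivation ℂ R R)

instance : AddCommGroup (PsiDO δ) := inferInstanceAs (AddCommGroup (boundedAbove R))
instance : Module ℂ (PsiDO δ) := inferInstanceAs (Module ℂ (boundedAbove R))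

namespace PsiDO

variable {δ}

/-- The coefficient `aₙ` of `∂ⁿ` in `A = ∑ aₙ ∂ⁿ`. -/
def coeff (A : PsiDO δ) (n : ℤ) : R := A.1 n

/-- The operator with the given coefficients. -/
def mk (a : ℤ → R) (h : ∃ M : ℤ, ∀ n, M < n → a n = 0) : PsiDO δ := ⟨a, h⟩

@[simp] theorem coeff_mk (a : ℤ → R) (h) (n : ℤ) : (mk a h : PsiDO δ).coeff n = a n := rfl
@[simp] theorem coeff_zero (n : ℤ) : (0 : PsiDO δ).coeff n = 0 := rfl
@[simp] theorem coeff_add (A B : PsiDO δ) (n : ℤ) : (A + B).coeff n = A.coeff n + B.coeff n := rfl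
@[simp] theorem coeff_smul (c : ℂ) (A : PsiDO δ) (n : ℤ) : (c • A).coeff n = c • A.coeff n := rfl

@[ext] theorem ext {A B : PsiDO δ} (h : ∀ n, A.coeff n = B.coeff n) : A = B :=
  Subtype.ext (funext h)

theorem bdd (A : PsiDO δ) : ∃ M : ℤ, ∀ n, M < n → A.coeff n = 0 := A.2

/-- The monomial `a ∂ᵐ`. -/
def monomial (a : R) (m : ℤ) : PsiDO δ :=
  mk (fun n => if n = m then a else 0) ⟨m, fun _ hn => if_neg hn.ne'⟩

theorem support_finite (A : PsiDO δ) (s : ℤ) (f : ℕ → R →ₗ[ℂ] R) :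
    (Function.support fun k : ℕ => f k (A.coeff (s + k))).Finite := by
  obtain ⟨M, hM⟩ := A.bdd
  refine (Set.finite_Iio (M - s + 1).toNat).subset fun k hk => ?_
  by_contra hlt
  refine hk ?_
  simp only [Set.mem_Iio, not_lt] at hlt
  simp [hM (s + k) (by omega)]

/-- The linear operator `B ↦ ∑_N (∑_{k ≥ 0} f N k (b_{N-m+k})) ∂^N` (all inner sums are finite). -/
def lowering (m : ℤ) (f : ℤ → ℕ → R →ₗ[ℂ] R) : PsiDO δ →ₗ[ℂ] PsiDO δ where
  toFun B := mk (fun N => ∑ᶠ k : ℕ, f N k (B.coeff (N - m + k))) <| by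
    obtain ⟨M, hM⟩ := B.bdd
    refine ⟨M + m, fun n hn => ?_⟩
    have h : ∀ k : ℕ, f n k (B.coeff (n - m + k)) = 0 := fun k => by
      simp [hM (n - m + k) (by omega)]
    simp [h]
  map_add' A B := by
    ext N
    simp only [coeff_mk, coeff_add, map_add]
    exact finsum_add_distrib (support_finite A _ _) (support_finite B _ _)
  map_smul' c A := by
    ext N
    simp only [coeff_mk, coeff_smul, map_smul, RingHom.id_apply]
    exact (smul_finsum' c (support_finite A _ _)).symm

variable (δ) in
/-- The iterated derivative `δᵏ`. -/
def iter (k : ℕ) : R →ₗ[ℂ] R := (δ : R →ₗ[ℂ] R) ^ k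

/-- Left multiplication by `∂ᵐ`, `m ∈ ℤ`, that is,
`∂ᵐ ∘ (b ∂ⁿ) = ∑_{k ≥ 0} (m choose k) δᵏ(b) ∂^{m+n-k}`. -/
def dPow (m : ℤ) : PsiDO δ →ₗ[ℂ] PsiDO δ :=
  lowering m fun _ k => Ring.choose m k • iter δ k

theorem dPow_coeff (m : ℤ) (B : PsiDO δ) (N : ℤ) :
    (dPow m B).coeff N = ∑ᶠ k : ℕ, Ring.choose m k • iter δ k (B.coeff (N - m + k)) := rfl

theorem dPow_coeff_sum {m : ℤ} {B : PsiDO δ} {N : ℤ} {M : ℤ} (hM : ∀ n, M < n → B.coeff n = 0)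
    {K : ℕ} (hK : M < N - m + K) : (dPow m B).coeff N =
      ∑ k ∈ Finset.range K, Ring.choose m k • iter δ k (B.coeff (N - m + k)) := by
  rw [dPow_coeff]
  refine finsum_eq_sum_of_support_subset _ fun k hk => ?_
  by_contra hlt
  refine hk ?_
  simp only [Finset.coe_range, Set.mem_Iio, not_lt] at hlt
  simp [hM (N - m + k) (by omega)]

theorem dPow_coeff_eq_zero {m : ℤ} {B : PsiDO δ} {N : ℤ} {M : ℤ}
    (hM : ∀ n, M < n → B.coeff n = 0) (h : M < N - m) : (dPow m B).coeff N = 0 := by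
  rw [dPow_coeff_sum hM (K := 0) (by simpa using h)]
  simp

theorem mul_support_finite (A B : PsiDO δ) (N : ℤ) :
    (Function.support fun m : ℤ => A.coeff m * (dPow m B).coeff N).Finite := by
  obtain ⟨M, hM⟩ := A.bdd
  obtain ⟨L, hL⟩ := B.bdd
  refine (Set.finite_Icc (N - L) M).subset fun m hm => ?_
  by_contra hlt
  refine hm ?_
  simp only [Set.mem_Icc, not_and_or, not_le] at hlt
  rcases hlt with h | h
  · simp [dPow_coeff_eq_zero hL (show L < N - m by omega)]
  · simp [hM m h]

/-- The composition `A ∘ B = ∑ₘ aₘ (∂ᵐ ∘ B)` (for each coefficient this is a finite sum). -/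
instance : Mul (PsiDO δ) where
  mul A B := mk (fun N => ∑ᶠ m : ℤ, A.coeff m * (dPow m B).coeff N) <| by
    obtain ⟨M, hM⟩ := A.bdd
    obtain ⟨L, hL⟩ := B.bdd
    refine ⟨M + L, fun n hn => ?_⟩
    have h : ∀ m : ℤ, A.coeff m * (dPow m B).coeff n = 0 := fun m => by
      rcases lt_or_ge M m with h | h
      · simp [hM m h]
      · simp [dPow_coeff_eq_zero hL (show L < n - m by omega)]
    simp [h]

instance : One (PsiDO δ) := ⟨monomial 1 0⟩

theorem mul_coeff (A B : PsiDO δ) (N : ℤ) :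
    (A * B).coeff N = ∑ᶠ m : ℤ, A.coeff m * (dPow m B).coeff N := rfl

theorem one_coeff (N : ℤ) : (1 : PsiDO δ).coeff N = if N = 0 then 1 else 0 := rfl

theorem iter_succ (k : ℕ) (b : R) : iter δ (k + 1) b = δ (iter δ k b) := by
  simp [iter, pow_succ']

theorem iter_succ' (k : ℕ) (b : R) : iter δ (k + 1) b = iter δ k (δ b) := by
  simp [iter, pow_succ]

theorem dPow_zero (B : PsiDO δ) : dPow 0 B = B := by
  ext N
  rw [dPow_coeff, finsum_eq_single _ 0]
  · simp [iter]
  · intro k hk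
    obtain ⟨j, rfl⟩ := Nat.exists_eq_succ_of_ne_zero hk
    simp [Ring.choose_zero_succ]

theorem dPow_one_coeff (B : PsiDO δ) (N : ℤ) :
    (dPow 1 B).coeff N = B.coeff (N - 1) + δ (B.coeff N) := by
  rw [dPow_coeff, finsum_eq_sum_of_support_subset (s := Finset.range 2)]
  · simp [Finset.sum_range_succ, iter]
  · intro k hk
    by_contra hlt
    refine hk ?_
    simp only [Finset.coe_range, Set.mem_Iio, not_lt] at hlt
    have : Ring.choose (1 : ℤ) k = 0 := by
      have := Ring.choose_natCast (R := ℤ) 1 k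
      rw [Nat.choose_eq_zero_of_lt (by omega)] at this
      simpa using this
    simp [this]

/-- Pascal's rule in summed form. -/
theorem pascal_sum (m s : ℤ) (B : PsiDO δ) (K : ℕ) :
    ∑ k ∈ Finset.range (K + 1), Ring.choose (m + 1) k • iter δ k (B.coeff (s + k)) =
      ∑ k ∈ Finset.range (K + 1), Ring.choose m k • iter δ k (B.coeff (s + k)) +
      ∑ k ∈ Finset.range K, Ring.choose m k • iter δ (k + 1) (B.coeff (s + 1 + k)) := by
  rw [Finset.sum_range_succ', Finset.sum_range_succ' _ K]
  have h : ∀ k : ℕ, s + ((k + 1 : ℕ) : ℤ) = s + 1 + k := fun k => by push_cast; ring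
  simp only [Ring.choose_succ_succ, add_smul, Finset.sum_add_distrib, h, Ring.choose_zero_right]
  abel

theorem dPow_succ (m : ℤ) (B : PsiDO δ) : dPow (m + 1) B = dPow 1 (dPow m B) := by
  ext N
  obtain ⟨M, hM⟩ := B.bdd
  set K : ℕ := (M - (N - m - 1) + 1).toNat with hK
  rw [dPow_one_coeff, dPow_coeff_sum hM (K := K + 1) (by push_cast; omega),
    dPow_coeff_sum hM (K := K + 1) (by push_cast; omega),
    dPow_coeff_sum hM (K := K) (by omega), map_sum]
  have := pascal_sum (δ := δ) m (N - m - 1) B K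
  rw [show N - (m + 1) = N - m - 1 by ring, show N - 1 - m = N - m - 1 by ring, this]
  congr 1
  refine Finset.sum_congr rfl fun k _ => ?_
  rw [map_zsmul, ← iter_succ, show N - m - 1 + 1 + (k : ℤ) = N - m + k by ring]

theorem dPow_one_injective : Function.Injective (dPow (δ := δ) 1) := by
  rw [injective_iff_map_eq_zero]
  intro B hB
  obtain ⟨M, hM⟩ := B.bdd
  have key : ∀ j : ℕ, ∀ n : ℤ, M - j < n → B.coeff n = 0 := by
    intro j
    induction j with
    | zero => simpa using hM
    | succ j ih =>
      intro n hn
      have h := congrArg (fun A => A.coeff (n + 1)) hB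
      simp only [dPow_one_coeff, coeff_zero, add_sub_cancel_right] at h
      rw [ih (n + 1) (by push_cast at hn; omega)] at h
      simpa using h
  ext n
  exact key (M - n + 1).toNat n (by omega)

theorem dPow_one_mul (B C : PsiDO δ) : dPow 1 (B * C) = dPow 1 B * C := by
  ext N
  have hf := mul_support_finite B C N
  have hf1 := mul_support_finite B C (N - 1)
  rw [dPow_one_coeff, mul_coeff, mul_coeff, mul_coeff]
  have e1 : δ (∑ᶠ m : ℤ, B.coeff m * (dPow m C).coeff N) =
      ∑ᶠ m : ℤ, δ (B.coeff m * (dPow m C).coeff N) :=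
    (δ : R →ₗ[ℂ] R).toAddMonoidHom.map_finsum hf
  have hf2 : (Function.support fun m : ℤ => δ (B.coeff m * (dPow m C).coeff N)).Finite :=
    hf.subset fun m hm h => hm (by simp only [h, map_zero])
  obtain ⟨M, hM⟩ := B.bdd
  obtain ⟨L, hL⟩ := C.bdd
  have hs1 : (Function.support fun m : ℤ => δ (B.coeff m) * (dPow m C).coeff N).Finite := by
    refine (Set.finite_Icc (N - L) M).subset fun m hm => ?_
    by_contra hlt
    refine hm ?_
    simp only [Set.mem_Icc, not_and_or, not_le] at hlt
    rcases hlt with h | h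
    · simp [dPow_coeff_eq_zero hL (show L < N - m by omega)]
    · simp [hM m h]
  have hs2 : (Function.support fun m : ℤ => B.coeff (m - 1) * (dPow m C).coeff N).Finite := by
    refine (Set.finite_Icc (N - L) (M + 1)).subset fun m hm => ?_
    by_contra hlt
    refine hm ?_
    simp only [Set.mem_Icc, not_and_or, not_le] at hlt
    rcases hlt with h | h
    · simp [dPow_coeff_eq_zero hL (show L < N - m by omega)]
    · simp [hM (m - 1) (by omega)]
  have hs3 : (Function.support fun m : ℤ => B.coeff m * (dPow (m + 1) C).coeff N).Finite := by
    refine (Set.finite_Icc (N - L - 1) M).subset fun m hm => ?_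
    by_contra hlt
    refine hm ?_
    simp only [Set.mem_Icc, not_and_or, not_le] at hlt
    rcases hlt with h | h
    · simp [dPow_coeff_eq_zero hL (show L < N - (m + 1) by omega)]
    · simp [hM m h]
  rw [e1, ← finsum_add_distrib hf1 hf2]
  simp only [dPow_one_coeff B, add_mul]
  rw [finsum_add_distrib hs2 hs1]
  have e2 : ∑ᶠ m : ℤ, B.coeff (m - 1) * (dPow m C).coeff N =
      ∑ᶠ m : ℤ, B.coeff m * (dPow (m + 1) C).coeff N := by
    rw [← finsum_comp_equiv (Equiv.addRight (1 : ℤ))]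
    simp
  rw [e2, ← finsum_add_distrib hs3 hs1]
  refine finsum_congr fun m => ?_
  rw [dPow_succ, dPow_one_coeff, Derivation.leibniz]
  simp only [smul_eq_mul]
  ring

theorem dPow_mul (m : ℤ) (B C : PsiDO δ) : dPow m (B * C) = dPow m B * C := by
  induction m using Int.induction_on with
  | zero => simp [dPow_zero]
  | succ n ih => rw [dPow_succ, ih, dPow_one_mul, ← dPow_succ]
  | pred n ih =>
    apply dPow_one_injective
    rw [dPow_one_mul, ← dPow_succ, ← dPow_succ, sub_add_cancel, ih]

theorem psi_mul_assoc (A B C : PsiDO δ) : A * B * C = A * (B * C) := by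
  ext N
  obtain ⟨M, hM⟩ := A.bdd
  obtain ⟨L, hL⟩ := B.bdd
  obtain ⟨P, hP⟩ := C.bdd
  rw [mul_coeff, mul_coeff]
  simp only [dPow_mul]
  set S := Finset.Icc (N - P) (M + L)
  set T := Finset.Icc (N - P - L) M
  have h1 : ∀ n, (A * B).coeff n * (dPow n C).coeff N =
      ∑ m ∈ T, A.coeff m * (dPow m B).coeff n * (dPow n C).coeff N := by
    intro n
    by_cases hn : N - P ≤ n
    · rw [mul_coeff, finsum_eq_sum_of_support_subset (s := T), Finset.sum_mul]
      intro m hm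
      by_contra hlt
      refine hm ?_
      simp only [T, Finset.coe_Icc, Set.mem_Icc, not_and_or, not_le] at hlt
      rcases hlt with h | h
      · simp [dPow_coeff_eq_zero hL (show L < n - m by omega)]
      · simp [hM m h]
    · simp [dPow_coeff_eq_zero hP (show P < N - n by omega)]
  have h2 : ∀ m ∈ T, A.coeff m * (dPow m B * C).coeff N =
      ∑ n ∈ S, A.coeff m * (dPow m B).coeff n * (dPow n C).coeff N := by
    intro m hm
    rw [mul_coeff, finsum_eq_sum_of_support_subset (s := S), Finset.mul_sum]
    · simp only [mul_assoc]
    · intro n hn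
      by_contra hlt
      refine hn ?_
      simp only [S, Finset.coe_Icc, Set.mem_Icc, not_and_or, not_le] at hlt
      simp only [T, Finset.mem_Icc] at hm
      rcases hlt with h | h
      · simp [dPow_coeff_eq_zero hP (show P < N - n by omega)]
      · simp [dPow_coeff_eq_zero hL (show L < n - m by omega)]
  rw [finsum_eq_sum_of_support_subset (s := S), finsum_eq_sum_of_support_subset (s := T)]
  · rw [Finset.sum_congr rfl h2, Finset.sum_comm]
    exact Finset.sum_congr rfl fun n _ => h1 n
  · intro m hm
    by_contra hlt
    refine hm ?_
    simp only [T, Finset.coe_Icc, Set.mem_Icc, not_and_or, not_le] at hlt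
    rcases hlt with h | h
    · have hBC : ∀ n, L + P < n → (B * C).coeff n = 0 := by
        intro n hn
        rw [mul_coeff]
        refine finsum_eq_zero_of_forall_eq_zero fun j => ?_
        rcases lt_or_ge L j with h | h
        · simp [hL j h]
        · simp [dPow_coeff_eq_zero hP (show P < n - j by omega)]
      simp [← dPow_mul, dPow_coeff_eq_zero hBC (show L + P < N - m by omega)]
    · simp [hM m h]
  · intro n hn
    by_contra hlt
    refine hn ?_
    simp only [S, Finset.coe_Icc, Set.mem_Icc, not_and_or, not_le] at hlt
    rcases hlt with h | h
    · simp [dPow_coeff_eq_zero hP (show P < N - n by omega)]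
    · have : (A * B).coeff n = 0 := by
        rw [mul_coeff]
        refine finsum_eq_zero_of_forall_eq_zero fun j => ?_
        rcases lt_or_ge M j with h | h
        · simp [hM j h]
        · simp [dPow_coeff_eq_zero hL (show L < n - j by omega)]
      simp [this]

theorem psi_one_mul (A : PsiDO δ) : 1 * A = A := by
  ext N
  rw [mul_coeff, finsum_eq_single _ 0]
  · simp [one_coeff, dPow_zero]
  · intro m hm
    simp [one_coeff, hm]

theorem dPow_one_op (m N : ℤ) : (dPow m (1 : PsiDO δ)).coeff N = if N = m then 1 else 0 := by
  rw [dPow_coeff, finsum_eq_single _ 0]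
  · simp [iter, one_coeff, sub_eq_zero]
  · intro k hk
    obtain ⟨j, rfl⟩ := Nat.exists_eq_succ_of_ne_zero hk
    rw [Nat.succ_eq_add_one, iter_succ', one_coeff]
    split_ifs <;> simp

theorem psi_mul_one (A : PsiDO δ) : A * 1 = A := by
  ext N
  rw [mul_coeff, finsum_eq_single _ N]
  · simp [dPow_one_op]
  · intro m hm
    simp [dPow_one_op, hm.symm]

theorem psi_add_mul (A B C : PsiDO δ) : (A + B) * C = A * C + B * C := by
  ext N
  simp only [mul_coeff, coeff_add, add_mul]
  exact finsum_add_distrib (mul_support_finite A C N) (mul_support_finite B C N)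

theorem psi_mul_add (A B C : PsiDO δ) : A * (B + C) = A * B + A * C := by
  ext N
  simp only [mul_coeff, coeff_add, map_add, mul_add]
  exact finsum_add_distrib (mul_support_finite A B N) (mul_support_finite A C N)

/-- Formal pseudodifferential operators form an associative ring under composition. -/
instance : Ring (PsiDO δ) where
  __ := (inferInstance : AddCommGroup (PsiDO δ))
  mul := (· * ·)
  one := 1
  mul_assoc := psi_mul_assoc
  one_mul := psi_one_mul
  mul_one := psi_mul_one
  left_distrib := psi_mul_add
  right_distrib := psi_add_mul
  zero_mul A := by
    have h := psi_add_mul (0 : PsiDO δ) 0 A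
    rw [add_zero] at h
    exact left_eq_add.mp h
  mul_zero A := by
    have h := psi_mul_add A (0 : PsiDO δ) 0
    rw [add_zero] at h
    exact left_eq_add.mp h

instance : Algebra ℂ (PsiDO δ) :=
  Algebra.ofModule
    (fun c A B => by
      ext N
      simp only [mul_coeff, coeff_smul, smul_mul_assoc]
      exact (smul_finsum' c (mul_support_finite A B N)).symm)
    (fun c A B => by
      ext N
      simp only [mul_coeff, coeff_smul, map_smul, mul_smul_comm]
      exact (smul_finsum' c (mul_support_finite A B N)).symm)

/-- The Lie algebra structure is given by the commutator `⁅A, B⁆ = A * B - B * A`. -/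
instance : LieRing (PsiDO δ) := LieRing.ofAssociativeRing

/-- The derivation `ad (ln ∂)`:
`[ln ∂, a ∂ⁿ] = ∑_{k ≥ 1} ((-1)^{k-1} / k) δᵏ(a) ∂^{n-k}`. -/
def adLogD : PsiDO δ →ₗ[ℂ] PsiDO δ :=
  lowering (-1) fun _ k => ((-1 : ℂ) ^ k / ((k : ℂ) + 1)) • iter δ (k + 1)

/-- The derivation `ad (ln x)`, where `y = δ (ln x)` is the logarithmic derivative of `x`:
`[ln x, a ∂ⁿ] = - ∑_{k ≥ 1} (n choose k) a δᵏ⁻¹(y) ∂^{n-k}`. -/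
def adLogX (y : R) : PsiDO δ →ₗ[ℂ] PsiDO δ :=
  lowering (-1) fun N k =>
    -(Ring.choose (N + (k + 1)) (k + 1) • LinearMap.mulRight ℂ (iter δ k y))

theorem adLogD_coeff (A : PsiDO δ) (N : ℤ) : (adLogD A).coeff N =
    ∑ᶠ k : ℕ, ((-1 : ℂ) ^ k / ((k : ℂ) + 1)) • iter δ (k + 1) (A.coeff (N + (k + 1))) := by
  simp only [adLogD, lowering, LinearMap.coe_mk, AddHom.coe_mk, coeff_mk, LinearMap.smul_apply]
  refine finsum_congr fun k => ?_
  rw [show N - -1 + (k : ℤ) = N + (k + 1) by ring]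

theorem adLogX_coeff (y : R) (A : PsiDO δ) (N : ℤ) : (adLogX y A).coeff N =
    ∑ᶠ k : ℕ, -(Ring.choose (N + (k + 1)) (k + 1) • (A.coeff (N + (k + 1)) * iter δ k y)) := by
  simp only [adLogX, lowering, LinearMap.coe_mk, AddHom.coe_mk, coeff_mk, LinearMap.neg_apply,
    LinearMap.smul_apply, LinearMap.mulRight_apply]
  refine finsum_congr fun k => ?_
  rw [show N - -1 + (k : ℤ) = N + (k + 1) by ring]

end PsiDO

end Symbols

/-! ### Smooth functions on the circle -/

/-- The algebra `C^∞(S¹)` of smooth complex functions on the unit circle, as smooth `2π`-periodic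
functions of the angle `θ`. -/
def CircleFun : Subalgebra ℂ (ℝ → ℂ) where
  carrier := {f | ContDiff ℝ (⊤ : ℕ∞) f ∧ Function.Periodic f (2 * Real.pi)}
  mul_mem' hf hg := ⟨hf.1.mul hg.1, hf.2.mul hg.2⟩
  add_mem' hf hg := ⟨hf.1.add hg.1, hf.2.add hg.2⟩
  algebraMap_mem' _ := ⟨contDiff_const, fun _ => rfl⟩

namespace CircleFun

/-- The function `x^n = e^{inθ}`, `n ∈ ℤ`, where `x = e^{iθ}` is the coordinate on the circle. -/
def xPow (n : ℤ) : CircleFun :=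
  ⟨fun θ => Complex.exp (n * (θ * Complex.I)), by
    constructor
    · exact (contDiff_const.mul (Complex.ofRealCLM.contDiff.mul contDiff_const)).cexp
    · intro θ
      have : (n : ℂ) * (((θ + 2 * Real.pi : ℝ) : ℂ) * Complex.I) =
          n * (θ * Complex.I) + n * (2 * Real.pi * Complex.I) := by push_cast; ring
      simp only [this, Complex.exp_periodic.int_mul n (n * (θ * Complex.I))]⟩

/-- The derivative `df/dx = (i x)⁻¹ df/dθ` with respect to the coordinate `x = e^{iθ}`. -/
def ddx : Derivation ℂ CircleFun CircleFun :=
  Derivation.mk'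
    { toFun := fun f => ⟨fun θ => -Complex.I * (xPow (-1)).1 θ * deriv f.1 θ, by
        refine ⟨(contDiff_const.mul (xPow (-1)).2.1).mul ?_, ?_⟩
        · exact (contDiff_infty_iff_deriv.mp f.2.1).2
        · intro θ
          have h1 := (xPow (-1)).2.2 θ
          have h2 : deriv f.1 (θ + 2 * Real.pi) = deriv f.1 θ := by
            rw [← deriv_comp_add_const]
            congr 1
            exact funext f.2.2
          simp only [h1, h2]⟩
      map_add' := fun f g => by
        ext θ
        have hf : DifferentiableAt ℝ f.1 θ := (f.2.1.differentiable (by simp)) θ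
        have hg : DifferentiableAt ℝ g.1 θ := (g.2.1.differentiable (by simp)) θ
        change _ * deriv (f.1 + g.1) θ = _ * deriv f.1 θ + _ * deriv g.1 θ
        rw [deriv_add hf hg]
        ring
      map_smul' := fun c f => by
        ext θ
        have hf : DifferentiableAt ℝ f.1 θ := (f.2.1.differentiable (by simp)) θ
        change _ * deriv (c • f.1) θ = c * (_ * deriv f.1 θ)
        rw [deriv_const_smul c hf, smul_eq_mul]
        ring }
    (fun f g => by
      ext θ
      have hf : DifferentiableAt ℝ f.1 θ := (f.2.1.differentiable (by simp)) θ
      have hg : DifferentiableAt ℝ g.1 θ := (g.2.1.differentiable (by simp)) θ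
      change _ * deriv (f.1 * g.1) θ = f.1 θ * (_ * deriv g.1 θ) + g.1 θ * (_ * deriv f.1 θ)
      rw [deriv_mul hf hg]
      ring)

/-- The coefficient of `x⁻¹` in the Fourier series `f = ∑ fₙ xⁿ`, that is,
`(1/2πi) ∮ f dx = (1/2π) ∫₀^{2π} f(θ) e^{iθ} dθ`. -/
def res : CircleFun →ₗ[ℂ] ℂ where
  toFun f := (1 / (2 * Real.pi) : ℂ) * ∫ θ in (0 : ℝ)..(2 * Real.pi), f.1 θ * (xPow 1).1 θ
  map_add' f g := by
    have hi : ∀ h : CircleFun, IntervalIntegrable (fun θ => h.1 θ * (xPow 1).1 θ)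
        MeasureTheory.volume 0 (2 * Real.pi) := fun h =>
      (h.2.1.continuous.mul (xPow 1).2.1.continuous).intervalIntegrable _ _
    rw [← mul_add, ← intervalIntegral.integral_add (hi f) (hi g)]
    congr 2
    funext θ
    exact add_mul _ _ _
  map_smul' c f := by
    simp only [RingHom.id_apply, smul_eq_mul]
    rw [mul_left_comm c, ← intervalIntegral.integral_const_mul c]
    congr 2
    funext θ
    exact mul_assoc _ _ _

end CircleFun

/-! ### The algebra `ΨDif(S¹)` and its structures -/

/-- `ΨDif(S¹)`: formal series `∑_{n ≤ M} aₙ(x) ∂ⁿ`, `aₙ ∈ C^∞(S¹)`, `∂ = d/dx`. It is an associative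
algebra, hence a Lie algebra with `⁅A, B⁆ = A * B - B * A`. -/
abbrev PsiDif : Type := PsiDO CircleFun.ddx

namespace PsiDif

/-- The operator of multiplication by `x`. -/
def x : PsiDif := PsiDO.monomial (CircleFun.xPow 1) 0

/-- The operator `∂ = d/dx`. -/
def d : PsiDif := PsiDO.monomial 1 1

/-- The noncommutative residue: the coefficient of `x⁻¹ ∂⁻¹`. -/
def Tr : PsiDif →ₗ[ℂ] ℂ where
  toFun A := CircleFun.res (A.coeff (-1))
  map_add' A B := by simp
  map_smul' c A := by simp

/-- `D₁ = ad (ln ∂)` is `D 0` and `D₂ = ad (ln x)` is `D 1`. -/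
def D : Fin 2 → PsiDif →ₗ[ℂ] PsiDif :=
  ![PsiDO.adLogD, PsiDO.adLogX (CircleFun.xPow (-1))]

/-- `Q = ∑_{n ≥ 1} ((n-1)!/n) x⁻ⁿ ∂⁻ⁿ`. -/
def Q : PsiDif :=
  PsiDO.mk
    (fun m => if m < 0 then
      (((m.natAbs - 1).factorial : ℂ) / (m.natAbs : ℂ)) • CircleFun.xPow m else 0)
    ⟨0, fun _ hn => if_neg hn.le.not_gt⟩

/-- The trilinear form `(A₁, A₂, A₃) ↦ Tr (E A₁ · F A₂ · G A₃)`. -/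
def trProd (E F G : PsiDif →ₗ[ℂ] PsiDif) : MultilinearMap ℂ (fun _ : Fin 3 => PsiDif) ℂ :=
  Tr.compMultilinearMap ((MultilinearMap.mkPiAlgebraFin ℂ 3 PsiDif).compLinearMap ![E, F, G])

/-- The cochain `Ψ₃ = Alt_{A,D} Tr(D₁A₁ · D₂A₂ · A₃) + Alt_A Tr(Q · A₁ · A₂ · A₃)`. Here `Alt_A` and
`Alt_D` are the signed sums, without normalizing factors, over all permutations of the operators
`A₁, A₂, A₃` and of the derivations `D₁, D₂`. -/
def Psi3 : PsiDif [⋀^Fin 3]→ₗ[ℂ] ℂ :=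
  MultilinearMap.alternatization
      (∑ τ : Equiv.Perm (Fin 2), Equiv.Perm.sign τ • trProd (D (τ 0)) (D (τ 1)) LinearMap.id) +
    MultilinearMap.alternatization (trProd (LinearMap.mulLeft ℂ Q) LinearMap.id LinearMap.id)

theorem Psi3_apply (A : Fin 3 → PsiDif) : Psi3 A =
    (∑ σ : Equiv.Perm (Fin 3), Equiv.Perm.sign σ •
      ∑ τ : Equiv.Perm (Fin 2), Equiv.Perm.sign τ •
        Tr (D (τ 0) (A (σ 0)) * D (τ 1) (A (σ 1)) * A (σ 2))) +
    ∑ σ : Equiv.Perm (Fin 3), Equiv.Perm.sign σ • Tr (Q * A (σ 0) * A (σ 1) * A (σ 2)) := by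
  simp only [Psi3, AlternatingMap.add_apply, MultilinearMap.alternatization_apply]
  simp [trProd, mul_assoc]

/-- The Lie algebra `Dif₁` of polynomial differential operators `∑ pₖ(x) ∂ᵏ` (`k ≥ 0`, `pₖ ∈ ℂ[x]`):
the associative subalgebra generated by `x` and `∂`, with the commutator bracket. -/
def Dif1 : LieSubalgebra ℂ PsiDif :=
  lieSubalgebraOfSubalgebra ℂ PsiDif (Algebra.adjoin ℂ {x, d})

/-- The element `1` of `Dif₁`. -/
def oneDif : Dif1 := ⟨1, (Algebra.adjoin ℂ {x, d}).one_mem⟩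
/-- The element `x` of `Dif₁`. -/
def xDif : Dif1 := ⟨x, Algebra.subset_adjoin (by simp)⟩
/-- The element `∂` of `Dif₁`. -/
def dDif : Dif1 := ⟨d, Algebra.subset_adjoin (by simp)⟩

end PsiDif

/-! ### Cochains and chains of a Lie algebra with trivial coefficients -/

section Cohomology

variable {L : Type*} [LieRing L] [LieAlgebra ℂ L] {n : ℕ}

/-- The Chevalley–Eilenberg differential of an `n`-cochain with trivial coefficients:
`(dφ)(A₀,…,Aₙ) = ½ ∑ᵢ (-1)ⁱ ∑_{j ≠ i} φ(A₀,…,[Aᵢ,Aⱼ],…,Âᵢ,…,Aₙ)`, with `[Aᵢ,Aⱼ]` at the place of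
`Aⱼ`. -/
def ceDifferential (φ : L [⋀^Fin n]→ₗ[ℂ] ℂ) (A : Fin (n + 1) → L) : ℂ :=
  (1 / 2 : ℂ) * ∑ i : Fin (n + 1), (-1 : ℂ) ^ (i : ℕ) *
    ∑ j : Fin n, φ (Function.update (i.removeNth A) j ⁅A i, i.removeNth A j⁆)

/-- The Chevalley–Eilenberg boundary of the `(n+1)`-chain `A₀ ∧ … ∧ Aₙ`, with the same sign
convention. -/
def ceBoundary (A : Fin (n + 1) → L) : ExteriorAlgebra ℂ L :=
  (1 / 2 : ℂ) • ∑ i : Fin (n + 1), (-1 : ℂ) ^ (i : ℕ) •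
    ∑ j : Fin n, ExteriorAlgebra.ιMulti ℂ n
      (Function.update (i.removeNth A) j ⁅A i, i.removeNth A j⁆)

/-- `φ` is a cocycle. -/
def IsCocycle (φ : L [⋀^Fin n]→ₗ[ℂ] ℂ) : Prop := ∀ A, ceDifferential φ A = 0

/-- `ψ` is cohomologous to zero: it is the differential of some cochain of degree one less. -/
def IsCoboundary (ψ : L [⋀^Fin (n + 1)]→ₗ[ℂ] ℂ) : Prop :=
  ∃ φ : L [⋀^Fin n]→ₗ[ℂ] ℂ, ∀ A, ceDifferential φ A = ψ A

/-- The restriction of a cochain to a Lie subalgebra. -/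
def restrictCochain (𝔤 : LieSubalgebra ℂ L) (φ : L [⋀^Fin n]→ₗ[ℂ] ℂ) : 𝔤 [⋀^Fin n]→ₗ[ℂ] ℂ :=
  φ.compLinearMap (𝔤.incl : 𝔤 →ₗ[ℂ] L)

end Cohomology

end

/-! Write `D 0` and `D 1` for the commutators with `ln ∂` and `ln x`. The logarithms lie outside the
algebra, so the Leibniz rules and `[D 0, D 1] = ad Q` must be proved by calculation. All maps
involved shift the order by a bounded amount, so each coefficient of a result depends on finitely
many monomials. This reduces the Leibniz rule to left factors that are functions or `∂`
(`leibniz_of_generators`). The difference `[D 0, D 1] - ad Q` is then a derivation that vanishes on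
functions and on `∂`, hence zero (`eq_zero_of_generators`).

The residue is a trace (`Tr_mul_comm`, by integration by parts) and kills the images of both
derivations (`Tr_D`). The cocycle property follows from these facts alone. The Lie differential of
an alternated trilinear form is the alternation of a Hochschild-type coboundary
(`ceDifferential_eq_altSum4`), which the Leibniz rule collapses to three terms. Subtracting `Tr (D 1
(D 0 a * b * c * d)) = 0` from `Tr (D 0 (D 1 a * b * c * d)) = 0` and alternating gives twice the
desired vanishing, because a cyclic shift of four letters is odd (`altSum4_eq_zero`).

For nontriviality, `1` is central and `[x, ∂] = -1`, so in the boundary of `1 ∧ x ∧ ∂` every term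
has a zero factor or a repeated one. Every coboundary therefore vanishes at `(1, x, ∂)`, while
`Psi3` takes the value `-3` there (`Psi3_one_x_d`). The argument works in any Lie subalgebra that
contains these three elements. -/

noncomputable section

namespace PsiDO

variable {R : Type*} [CommRing R] [Algebra ℂ R] {δ : Derivation ℂ R R}

/-! ### Order filtration and density of finite sums of monomials -/

/-- `A` has order at most `M`. -/
def OrderLE (A : PsiDO δ) (M : ℤ) : Prop := ∀ n, M < n → A.coeff n = 0

theorem coeff_sub (A B : PsiDO δ) (n : ℤ) : (A - B).coeff n = A.coeff n - B.coeff n := rfl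

theorem coeff_neg (A : PsiDO δ) (n : ℤ) : (-A).coeff n = -A.coeff n := rfl

theorem coeff_sum {ι : Type*} (s : Finset ι) (A : ι → PsiDO δ) (n : ℤ) :
    (∑ i ∈ s, A i).coeff n = ∑ i ∈ s, (A i).coeff n :=
  map_sum (AddMonoidHom.mk' (fun A : PsiDO δ => A.coeff n) fun _ _ => rfl) _ _

theorem coeff_monomial (a : R) (m n : ℤ) :
    (monomial a m : PsiDO δ).coeff n = if n = m then a else 0 := rfl

theorem OrderLE.mono {A : PsiDO δ} {M N : ℤ} (h : OrderLE A M) (hMN : M ≤ N) : OrderLE A N :=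
  fun n hn => h n (by omega)

theorem OrderLE.add {A B : PsiDO δ} {M : ℤ} (hA : OrderLE A M) (hB : OrderLE B M) :
    OrderLE (A + B) M := fun n hn => by rw [coeff_add, hA n hn, hB n hn, add_zero]

theorem OrderLE.sub {A B : PsiDO δ} {M : ℤ} (hA : OrderLE A M) (hB : OrderLE B M) :
    OrderLE (A - B) M := fun n hn => by rw [coeff_sub, hA n hn, hB n hn, sub_zero]

theorem OrderLE.mul {A B : PsiDO δ} {M L : ℤ} (hA : OrderLE A M) (hB : OrderLE B L) :
    OrderLE (A * B) (M + L) := fun n hn => by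
  rw [mul_coeff]
  refine finsum_eq_zero_of_forall_eq_zero fun m => ?_
  rcases lt_or_ge M m with h | h
  · rw [hA m h, zero_mul]
  · rw [dPow_coeff_eq_zero hB (by omega), mul_zero]

theorem OrderLE.lowering {B : PsiDO δ} {M : ℤ} (hB : OrderLE B M) (m : ℤ)
    (f : ℤ → ℕ → R →ₗ[ℂ] R) : OrderLE (lowering m f B) (M + m) := fun n hn => by
  change ∑ᶠ k : ℕ, f n k (B.coeff (n - m + k)) = 0
  refine finsum_eq_zero_of_forall_eq_zero fun k => ?_
  rw [hB _ (by omega), map_zero]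

theorem exists_orderLE_sub_sum_monomial (A : PsiDO δ) (L : ℤ) :
    ∃ s : Finset ℤ, OrderLE (A - ∑ m ∈ s, monomial (A.coeff m) m) L := by
  obtain ⟨M, hM⟩ := A.bdd
  refine ⟨Finset.Ioc L M, fun n hn => ?_⟩
  simp only [coeff_sub, coeff_sum, coeff_monomial, Finset.sum_ite_eq, Finset.mem_Ioc]
  split_ifs with h
  · exact sub_self _
  · rw [hM n (by omega), sub_zero]

/-- Above order `L` an operator has only finitely many terms, so it is a finite sum of monomials up
to a remainder that `G` kills. This replaces a continuity argument. -/
theorem monomial_induction {V : Type*} [AddCommGroup V] [Module ℂ V] {G : PsiDO δ →ₗ[ℂ] V}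
    (L : ℤ) (hL : ∀ A, OrderLE A L → G A = 0) (hG : ∀ a m, G (monomial a m) = 0)
    (A : PsiDO δ) : G A = 0 := by
  obtain ⟨s, hs⟩ := A.exists_orderLE_sub_sum_monomial L
  rw [← sub_add_cancel A (∑ m ∈ s, monomial (A.coeff m) m), map_add, hL _ hs, map_sum,
    Finset.sum_eq_zero fun m _ => hG _ m, add_zero]

theorem monomial_induction_endo {G : PsiDO δ →ₗ[ℂ] PsiDO δ}
    (c : ℤ) (hc : ∀ A M, OrderLE A M → OrderLE (G A) (M + c))
    (hG : ∀ a m, G (monomial a m) = 0) (A : PsiDO δ) : G A = 0 := by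
  ext n
  let ev : PsiDO δ →ₗ[ℂ] R :=
    { toFun := fun A => A.coeff n, map_add' := fun _ _ => rfl, map_smul' := fun _ _ => rfl }
  -- Order at most `n - c - 1` is sent to order at most `n - 1`, where the `n`-th coefficient is
  -- zero.
  refine monomial_induction (G := ev ∘ₗ G) (n - c - 1)
    (fun A hA => hc A _ hA n (by omega)) (fun a m => ?_) A
  rw [LinearMap.comp_apply, hG, map_zero]

/-! ### Products with monomials -/

theorem monomial_mul_coeff (a : R) (m : ℤ) (B : PsiDO δ) (N : ℤ) :
    (monomial a m * B).coeff N = a * (dPow m B).coeff N := by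
  rw [mul_coeff, finsum_eq_single _ m]
  · rw [coeff_monomial, if_pos rfl]
  · intro k hk
    rw [coeff_monomial, if_neg hk, zero_mul]

theorem monomial_one_mul (m : ℤ) (B : PsiDO δ) : monomial 1 m * B = dPow m B := by
  ext N
  rw [monomial_mul_coeff, one_mul]

theorem monomial_zero_mul_coeff (a : R) (B : PsiDO δ) (N : ℤ) :
    (monomial a 0 * B).coeff N = a * B.coeff N := by
  rw [monomial_mul_coeff, dPow_zero]

theorem dPow_monomial_coeff (m : ℤ) (b : R) (n : ℤ) (k : ℕ) :
    (dPow m (monomial b n : PsiDO δ)).coeff (m + n - k) = Ring.choose m k • iter δ k b := by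
  rw [dPow_coeff, finsum_eq_single _ k]
  · rw [coeff_monomial, if_pos (by ring)]
  · intro j hj
    rw [coeff_monomial, if_neg (by omega), map_zero, smul_zero]

theorem dPow_monomial_one (m n : ℤ) :
    dPow m (monomial 1 n : PsiDO δ) = monomial 1 (m + n) := by
  ext N
  rw [dPow_coeff, finsum_eq_single _ 0]
  · simp only [Ring.choose_zero_right, coeff_monomial, Nat.cast_zero, add_zero, iter, pow_zero,
      one_smul, Module.End.one_apply]
    exact if_congr (by omega) rfl rfl
  · intro k hk
    obtain ⟨j, rfl⟩ := Nat.exists_eq_succ_of_ne_zero hk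
    rw [Nat.succ_eq_add_one, iter_succ', coeff_monomial]
    split_ifs <;> simp

theorem monomial_one_mul_monomial_one (m n : ℤ) :
    (monomial 1 m * monomial 1 n : PsiDO δ) = monomial 1 (m + n) := by
  rw [monomial_one_mul, dPow_monomial_one]

theorem monomial_one_zero : (monomial 1 0 : PsiDO δ) = 1 := rfl

theorem mul_monomial_one_coeff (A : PsiDO δ) (n N : ℤ) :
    (A * monomial 1 n).coeff N = A.coeff (N - n) := by
  rw [mul_coeff, finsum_eq_single _ (N - n)]
  · rw [dPow_monomial_one, coeff_monomial, if_pos (by ring), mul_one]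
  · intro m hm
    rw [dPow_monomial_one, coeff_monomial, if_neg (by omega), mul_zero]

theorem monomial_eq_mul (a : R) (m : ℤ) :
    (monomial a m : PsiDO δ) = monomial a 0 * monomial 1 m := by
  ext N
  rw [mul_monomial_one_coeff, coeff_monomial, coeff_monomial]
  exact if_congr (by omega) rfl rfl

/-! ### Operators of negative order -/

/-- The operator `∑_{j ≥ 0} fⱼ ∂^{-(j+1)}`. -/
def negOp (f : ℕ → R) : PsiDO δ :=
  mk (fun n => match n with
    | Int.ofNat _ => 0
    | Int.negSucc j => f j) ⟨0, fun n hn => by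
      obtain ⟨k, rfl⟩ := Int.eq_ofNat_of_zero_le hn.le
      rfl⟩

theorem negOp_coeff_natCast (f : ℕ → R) (k : ℕ) : (negOp f : PsiDO δ).coeff k = 0 := rfl

theorem negOp_coeff_negSucc (f : ℕ → R) (k : ℕ) :
    (negOp f : PsiDO δ).coeff (Int.negSucc k) = f k := rfl

theorem negOp_orderLE (f : ℕ → R) : OrderLE (negOp f : PsiDO δ) (-1) := fun n hn => by
  obtain ⟨k, rfl⟩ := Int.eq_ofNat_of_zero_le (show 0 ≤ n by omega)
  rfl

theorem eq_negOp {A : PsiDO δ} {f : ℕ → R} (hA : OrderLE A (-1))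
    (h : ∀ k : ℕ, A.coeff (Int.negSucc k) = f k) : A = negOp f := by
  ext n
  cases n with
  | ofNat k => exact hA _ (by simp only [Int.ofNat_eq_natCast]; omega)
  | negSucc k => exact h k

theorem monomial_orderLE (a : R) (m : ℤ) : OrderLE (monomial a m : PsiDO δ) m :=
  fun _ hn => if_neg hn.ne'

theorem monomial_zero_mul_negOp (a : R) (f : ℕ → R) :
    (monomial a 0 * negOp f : PsiDO δ) = negOp fun j => a * f j := by
  refine eq_negOp (by simpa using (monomial_orderLE a 0).mul (negOp_orderLE f)) fun k => ?_
  rw [monomial_zero_mul_coeff, negOp_coeff_negSucc]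

theorem negOp_mul_monomial_zero (f : ℕ → R) (b : R) :
    (negOp f * monomial b 0 : PsiDO δ) = negOp fun n => ∑ j ∈ Finset.range (n + 1),
      f j * Ring.choose (Int.negSucc j) (n - j) • iter δ (n - j) b := by
  refine eq_negOp (by simpa using (negOp_orderLE f).mul (monomial_orderLE b 0)) fun n => ?_
  rw [mul_coeff, finsum_eq_sum_of_support_subset
    (s := (Finset.range (n + 1)).map ⟨Int.negSucc, fun _ _ h => Int.negSucc.inj h⟩),
    Finset.sum_map]
  · refine Finset.sum_congr rfl fun j hj => ?_
    have hj' : j ≤ n := Nat.lt_succ_iff.mp (Finset.mem_range.mp hj)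
    have hn : Int.negSucc n = Int.negSucc j + 0 - (n - j : ℕ) := by omega
    change (negOp f).coeff (Int.negSucc j) *
      (dPow (Int.negSucc j) (monomial b 0)).coeff (Int.negSucc n) = _
    rw [negOp_coeff_negSucc, hn, dPow_monomial_coeff]
  · intro m hm
    cases m with
    | ofNat k => exact absurd (by simp [negOp_coeff_natCast]) hm
    | negSucc j =>
      by_contra hlt
      refine hm ?_
      have : n < j := by
        by_contra h
        exact hlt (by simpa using ⟨j, by omega, rfl⟩)
      change _ * _ = (0 : R)
      rw [dPow_coeff_eq_zero (monomial_orderLE b 0) (by omega), mul_zero]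

end PsiDO

namespace PsiDO

variable {R : Type*} [CommRing R] [Algebra ℂ R] {δ : Derivation ℂ R R}

/-! ### Binomial identities -/

/-- Upper negation. For exponents with `m + n = k - 1` it compares the `∂⁻¹` coefficients of two
monomials multiplied in either order. -/
theorem choose_neg_eq (m : ℤ) (k : ℕ) :
    Ring.choose (k - 1 - m) k = (-1) ^ k * Ring.choose m k := by
  have h := Ring.choose_neg (m + 1 - k) k
  rw [show -(m + 1 - (k : ℤ)) = k - 1 - m by ring, show m + 1 - (k : ℤ) + k - 1 = m by ring] at h
  rw [h, Int.negOnePow_def, Units.smul_def]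
  simp

/-- The scalar identity behind both the Leibniz rule for `ad (ln ∂)` on functions and the formula
for `[ln ∂, ln x]`: on the right only `p + l` and an ordinary binomial coefficient remain, whose
symmetry can then be used. -/
theorem choose_negSucc_mul (p l : ℕ) :
    (-1 : ℂ) ^ p / (p + 1) * (Ring.choose (Int.negSucc p) l : ℤ) =
      (-1) ^ (p + l) / (p + l + 1) * (p + l + 1).choose l := by
  have h1 : Ring.choose (Int.negSucc p) l = (-1) ^ l * ((p + l).choose l : ℤ) := by
    rw [show Int.negSucc p = (l : ℤ) - 1 - ((p + l : ℕ) : ℤ) by push_cast; omega, choose_neg_eq,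
      Ring.choose_natCast]
  have h2 : ((p + l + 1).choose l : ℂ) * (p + 1) = (p + l).choose l * (p + l + 1) := by
    have := Nat.choose_mul_succ_eq (p + l) l
    rw [show p + l + 1 - l = p + 1 by omega] at this
    exact_mod_cast this.symm
  have h3 : (p : ℂ) + 1 ≠ 0 := Nat.cast_add_one_ne_zero p
  have h4 : (p : ℂ) + l + 1 ≠ 0 := by
    simpa using Nat.cast_add_one_ne_zero (R := ℂ) (p + l)
  rw [h1]
  push_cast
  rw [pow_add]
  field_simp
  linear_combination -h2

/-! ### Derivation properties -/

theorem iter_mul (n : ℕ) (a b : R) : iter δ n (a * b) =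
    ∑ i ∈ Finset.range (n + 1), n.choose i • (iter δ i a * iter δ (n - i) b) := by
  rw [← Finset.Nat.sum_antidiagonal_eq_sum_range_succ
    (fun i j => n.choose i • (iter δ i a * iter δ j b))]
  induction n with
  | zero => simp [iter]
  | succ n ih =>
    rw [Finset.sum_antidiagonal_choose_succ_nsmul (fun i j => iter δ i a * iter δ j b), iter_succ,
      ih, map_sum, ← Finset.sum_add_distrib]
    refine Finset.sum_congr rfl fun ij hij => ?_
    have hs : n.choose ij.2 = n.choose ij.1 :=
      (Nat.choose_symm_of_eq_add (Finset.HasAntidiagonal.mem_antidiagonal.mp hij).symm).symm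
    rw [map_nsmul, Derivation.leibniz, hs, ← smul_add, iter_succ, iter_succ]
    simp only [smul_eq_mul]
    ring

/-- `D` satisfies the Leibniz rule for products with left factor `A`. -/
def LeibnizAt (D : PsiDO δ →ₗ[ℂ] PsiDO δ) (A : PsiDO δ) : Prop :=
  ∀ B, D (A * B) = D A * B + A * D B

variable {D : PsiDO δ →ₗ[ℂ] PsiDO δ}

theorem LeibnizAt.mul {A B : PsiDO δ} (hA : LeibnizAt D A) (hB : LeibnizAt D B) :
    LeibnizAt D (A * B) := fun C => by
  rw [mul_assoc, hA, hB, hA]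
  noncomm_ring

/-- Differentiating `A * B = 1` forces `D B = -(B * D A * B)`; the rule for `B` then follows by
applying the rule for `A` to `A * (B * C)`. It is needed to pass from `∂` to `∂⁻¹`. -/
theorem LeibnizAt.inv {A B : PsiDO δ} (hA : LeibnizAt D A) (h : A * B = 1) (h' : B * A = 1)
    (h1 : D 1 = 0) : LeibnizAt D B := fun C => by
  have e1 : D A * B + A * D B = 0 := by rw [← hA, h, h1]
  have e2 : D C = D A * (B * C) + A * D (B * C) := by rw [← hA, ← mul_assoc, h, one_mul]
  have e3 : D B = -(B * D A * B) := by
    calc D B = B * A * D B := by rw [h', one_mul]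
      _ = B * (D A * B + A * D B) - B * D A * B := by noncomm_ring
      _ = _ := by rw [e1]; noncomm_ring
  calc D (B * C) = B * A * D (B * C) := by rw [h', one_mul]
    _ = B * (D A * (B * C) + A * D (B * C)) - B * D A * B * C := by noncomm_ring
    _ = _ := by rw [← e2, e3]; noncomm_ring

/-- Left factors obeying the rule are closed under products and inverses, so functions and `∂` yield
every monomial `a ∂ᵐ`. For fixed `B` the defect is linear in `A` and shifts order by a bounded
amount, so monomials suffice. -/
theorem leibniz_of_generators (c : ℤ) (hc : ∀ A M, OrderLE A M → OrderLE (D A) (M + c))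
    (h1 : D 1 = 0) (ha : ∀ a, LeibnizAt D (monomial a 0)) (hd : LeibnizAt D (monomial 1 1))
    (A B : PsiDO δ) : D (A * B) = D A * B + A * D B := by
  have hd' : LeibnizAt D (monomial 1 (-1)) :=
    hd.inv (by rw [monomial_one_mul_monomial_one]; rfl)
      (by rw [monomial_one_mul_monomial_one]; rfl) h1
  have hm : ∀ m : ℤ, LeibnizAt D (monomial 1 m) := fun m => by
    induction m using Int.induction_on with
    | zero => exact ha 1
    | succ n ih => simpa only [monomial_one_mul_monomial_one] using ih.mul hd
    | pred n ih =>
      simpa only [monomial_one_mul_monomial_one, ← sub_eq_add_neg] using ih.mul hd'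
  obtain ⟨L, hL⟩ : ∃ L, OrderLE B L := B.bdd
  let G : PsiDO δ →ₗ[ℂ] PsiDO δ := D ∘ₗ LinearMap.mulRight ℂ B -
    (LinearMap.mulRight ℂ B ∘ₗ D + LinearMap.mulRight ℂ (D B))
  refine sub_eq_zero.mp (monomial_induction_endo (G := G) (L + c) (fun A M hA => ?_)
    (fun a m => ?_) A)
  · have e1 := hc _ _ (hA.mul hL)
    have e2 := (hc _ _ hA).mul hL
    have e3 := hA.mul (hc _ _ hL)
    exact (e1.mono (by omega)).sub ((e2.mono (by omega)).add (e3.mono (by omega)))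
  · refine sub_eq_zero.mpr ?_
    rw [monomial_eq_mul]
    exact (ha a).mul (hm m) B

/-- A derivation that vanishes on the functions and on `∂` is zero. -/
theorem eq_zero_of_generators (c : ℤ) (hc : ∀ A M, OrderLE A M → OrderLE (D A) (M + c))
    (hD : ∀ A B, D (A * B) = D A * B + A * D B) (ha : ∀ a, D (monomial a 0) = 0)
    (hd : D (monomial 1 1) = 0) (A : PsiDO δ) : D A = 0 := by
  have hd' : D (monomial 1 (-1)) = 0 := by
    have h := hD (monomial 1 (-1)) (monomial 1 1)
    rw [monomial_one_mul_monomial_one, hd, mul_zero, add_zero] at h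
    -- `D(∂⁻¹) ∂ = D(1) = 0`, and right multiplication by `∂⁻¹` cancels the factor `∂`.
    have h2 : D (monomial 1 (-1)) * monomial 1 1 * monomial 1 (-1) = 0 := by
      rw [← h, show (-1 + 1 : ℤ) = 0 from rfl, ha, zero_mul]
    rwa [mul_assoc, monomial_one_mul_monomial_one, show (1 + -1 : ℤ) = 0 from rfl,
      monomial_one_zero, mul_one] at h2
  have hm : ∀ m : ℤ, D (monomial 1 m) = 0 := fun m => by
    induction m using Int.induction_on with
    | zero => exact ha 1
    | succ n ih => rw [← monomial_one_mul_monomial_one, hD, ih, hd, zero_mul, mul_zero, add_zero]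
    | pred n ih =>
      rw [sub_eq_add_neg, ← monomial_one_mul_monomial_one, hD, ih, hd', zero_mul, mul_zero,
        add_zero]
  refine monomial_induction_endo c hc (fun a m => ?_) A
  rw [monomial_eq_mul, hD, ha, hm, zero_mul, mul_zero, add_zero]

/-! ### `ad (ln ∂)` -/

theorem adLogD_orderLE {A : PsiDO δ} {M : ℤ} (hA : OrderLE A M) : OrderLE (adLogD A) (M + -1) :=
  hA.lowering _ _

theorem adLogD_monomial_zero (a : R) : adLogD (monomial a 0 : PsiDO δ) =
    negOp fun j => ((-1 : ℂ) ^ j / ((j : ℂ) + 1)) • iter δ (j + 1) a := by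
  refine eq_negOp (by simpa using adLogD_orderLE (monomial_orderLE a 0)) fun k => ?_
  rw [adLogD_coeff, finsum_eq_single _ k]
  · rw [coeff_monomial, if_pos (by omega)]
  · intro j hj
    rw [coeff_monomial, if_neg (by omega), map_zero, smul_zero]

theorem adLogD_monomial_one (m : ℤ) : adLogD (monomial 1 m : PsiDO δ) = 0 := by
  ext N
  rw [adLogD_coeff]
  refine finsum_eq_zero_of_forall_eq_zero fun k => ?_
  rw [iter_succ', coeff_monomial]
  split_ifs <;> simp

theorem adLogD_mul_monomial_one (A : PsiDO δ) (n : ℤ) :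
    adLogD (A * monomial 1 n) = adLogD A * monomial 1 n := by
  ext N
  rw [mul_monomial_one_coeff, adLogD_coeff, adLogD_coeff]
  refine finsum_congr fun k => ?_
  rw [mul_monomial_one_coeff, show N + ((k : ℤ) + 1) - n = N - n + (k + 1) by ring]

theorem adLogD_dPow_one (B : PsiDO δ) : adLogD (dPow 1 B) = dPow 1 (adLogD B) := by
  ext N
  have hs : ∀ n, (Function.support fun k : ℕ => ((-1 : ℂ) ^ k / ((k : ℂ) + 1)) •
      iter δ (k + 1) (B.coeff (n + (k + 1)))).Finite := fun n => by
    simpa only [add_assoc, add_comm (1 : ℤ), LinearMap.smul_apply]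
      using support_finite B (n + 1) fun k =>
      ((-1 : ℂ) ^ k / ((k : ℂ) + 1)) • iter δ (k + 1)
  rw [dPow_one_coeff, adLogD_coeff, adLogD_coeff, adLogD_coeff,
    show δ (∑ᶠ k : ℕ, ((-1 : ℂ) ^ k / ((k : ℂ) + 1)) • iter δ (k + 1) (B.coeff (N + (k + 1)))) =
      ∑ᶠ k : ℕ, δ (((-1 : ℂ) ^ k / ((k : ℂ) + 1)) • iter δ (k + 1) (B.coeff (N + (k + 1)))) from
      (δ : R →ₗ[ℂ] R).toAddMonoidHom.map_finsum (hs N), ← finsum_add_distrib (hs _)]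
  · refine finsum_congr fun k => ?_
    rw [dPow_one_coeff, map_add, smul_add, ← iter_succ', Derivation.map_smul, ← iter_succ,
      show N + ((k : ℤ) + 1) - 1 = N - 1 + (k + 1) by ring]
  · refine (hs N).subset fun k hk h => hk ?_
    simp only [h, map_zero]

/-- Both sides have negative order, and their coefficients are compared by expanding `δⁿ⁺¹(ab)` with
the higher Leibniz rule. -/
theorem adLogD_mul_functions (a b : R) :
    adLogD (monomial a 0 * monomial b 0 : PsiDO δ) =
      adLogD (monomial a 0) * monomial b 0 + monomial a 0 * adLogD (monomial b 0) := by
  have e : (monomial a 0 * monomial b 0 : PsiDO δ) = monomial (a * b) 0 := by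
    ext N
    rw [monomial_zero_mul_coeff, coeff_monomial, coeff_monomial, mul_ite, mul_zero]
  rw [e, adLogD_monomial_zero, adLogD_monomial_zero, adLogD_monomial_zero,
    negOp_mul_monomial_zero, monomial_zero_mul_negOp]
  refine (eq_negOp ((negOp_orderLE _).add (negOp_orderLE _)) fun n => ?_).symm
  -- The split-off term, with no derivative on `a`, is the contribution of `a [ln ∂, b]`; the others
  -- come from `[ln ∂, a] b`.
  rw [coeff_add, negOp_coeff_negSucc, negOp_coeff_negSucc, iter_mul,
    Finset.sum_range_succ' _ (n + 1), smul_add, Finset.smul_sum]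
  congr 1
  · refine Finset.sum_congr rfl fun j hj => ?_
    obtain ⟨l, rfl⟩ := Nat.exists_eq_add_of_le (Nat.lt_succ_iff.mp (Finset.mem_range.mp hj))
    have h := choose_negSucc_mul j l
    have h2 : (j + l + 1).choose l = (j + l + 1).choose (j + 1) :=
      Nat.choose_symm_of_eq_add (by ring)
    rw [show j + l - j = l by omega, show j + l + 1 - (j + 1) = l by omega, ← h2,
      ← Int.cast_smul_eq_zsmul ℂ, ← Nat.cast_smul_eq_nsmul ℂ, smul_mul_smul_comm, smul_smul, h]
    push_cast
    rfl
  · simp [iter]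

theorem adLogD_mul (A B : PsiDO δ) : adLogD (A * B) = adLogD A * B + A * adLogD B := by
  refine leibniz_of_generators (-1) (fun _ _ => adLogD_orderLE) (adLogD_monomial_one 0)
    (fun a B => ?_) (fun B => ?_) A B
  · let G : PsiDO δ →ₗ[ℂ] PsiDO δ := adLogD ∘ₗ LinearMap.mulLeft ℂ (monomial a 0) -
      (LinearMap.mulLeft ℂ (adLogD (monomial a 0)) + LinearMap.mulLeft ℂ (monomial a 0) ∘ₗ adLogD)
    refine sub_eq_zero.mp (monomial_induction_endo (G := G) (-1) (fun A M hA => ?_)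
      (fun b m => sub_eq_zero.mpr ?_) B)
    · have e1 := adLogD_orderLE ((monomial_orderLE (δ := δ) a 0).mul hA)
      have e2 := (adLogD_orderLE (monomial_orderLE (δ := δ) a 0)).mul hA
      have e3 := (monomial_orderLE (δ := δ) a 0).mul (adLogD_orderLE hA)
      exact (e1.mono (by omega)).sub ((e2.mono (by omega)).add (e3.mono (by omega)))
    · change adLogD (monomial a 0 * monomial b m) =
        adLogD (monomial a 0) * monomial b m + monomial a 0 * adLogD (monomial b m)
      rw [monomial_eq_mul b m, ← mul_assoc, adLogD_mul_monomial_one, adLogD_mul_functions,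
        adLogD_mul_monomial_one]
      noncomm_ring
  · rw [monomial_one_mul, monomial_one_mul, adLogD_dPow_one, adLogD_monomial_one, zero_mul,
      zero_add]

/-! ### `ad (ln x)` -/

theorem adLogX_orderLE (y : R) {A : PsiDO δ} {M : ℤ} (hA : OrderLE A M) :
    OrderLE (adLogX y A) (M + -1) :=
  hA.lowering _ _

theorem adLogX_monomial_zero (y a : R) : adLogX y (monomial a 0 : PsiDO δ) = 0 := by
  ext N
  rw [adLogX_coeff]
  refine finsum_eq_zero_of_forall_eq_zero fun k => ?_
  rw [coeff_monomial]
  split_ifs with h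
  · rw [h, Ring.choose_zero_succ, zero_smul, neg_zero]
  · simp

theorem adLogX_monomial_one_one (y : R) :
    adLogX y (monomial 1 1 : PsiDO δ) = monomial (-y) 0 := by
  ext N
  rw [adLogX_coeff, coeff_monomial]
  have h1 : ∀ k : ℕ, k ≠ 0 → Ring.choose (1 : ℤ) (k + 1) = 0 := fun k hk => by
    have := Ring.choose_natCast (R := ℤ) 1 (k + 1)
    rwa [Nat.choose_eq_zero_of_lt (by omega), Nat.cast_zero, Nat.cast_one] at this
  rw [finsum_eq_single _ 0]
  · rw [coeff_monomial]
    simp only [Nat.cast_zero, zero_add, add_eq_right]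
    split_ifs with h
    · subst h
      simp [iter]
    · simp
  · intro k hk
    rw [coeff_monomial]
    split_ifs with h
    · rw [h, h1 k hk, zero_smul, neg_zero]
    · simp

theorem adLogX_function_mul (y a : R) (B : PsiDO δ) :
    adLogX y (monomial a 0 * B) = monomial a 0 * adLogX y B := by
  ext N
  have hs : (Function.support fun k : ℕ => -(Ring.choose (N + (k + 1)) (k + 1) •
      (B.coeff (N + (k + 1)) * iter δ k y))).Finite := by
    simpa only [add_assoc, add_comm (1 : ℤ), LinearMap.smul_apply, LinearMap.neg_apply,
      LinearMap.mulRight_apply] using support_finite B (N + 1) fun k =>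
      -(Ring.choose (N + (k + 1)) (k + 1) • LinearMap.mulRight ℂ (iter δ k y))
  rw [monomial_zero_mul_coeff, adLogX_coeff, adLogX_coeff]
  refine Eq.trans ?_ ((AddMonoidHom.mulLeft a).map_finsum hs).symm
  refine finsum_congr fun k => ?_
  rw [monomial_zero_mul_coeff, AddMonoidHom.coe_mulLeft, mul_neg, mul_smul_comm, mul_assoc]

/-- The Leibniz rule for left factor `∂`, where `[ln x, ∂] = -y`. After truncation to finite sums it
comes from an index shift and Pascal's rule. -/
theorem adLogX_dPow_one (y : R) (B : PsiDO δ) :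
    adLogX y (dPow 1 B) = monomial (-y) 0 * B + dPow 1 (adLogX y B) := by
  ext N
  obtain ⟨M, hM⟩ := B.bdd
  have key : ∀ (A : PsiDO δ) (n : ℤ) (K : ℕ), OrderLE A (n + K) → (adLogX y A).coeff n =
      ∑ k ∈ Finset.range K, -(Ring.choose (n + (k + 1)) (k + 1) •
        (A.coeff (n + (k + 1)) * iter δ k y)) := by
    intro A n K hA
    rw [adLogX_coeff]
    refine finsum_eq_sum_of_support_subset _ fun k hk => ?_
    by_contra hlt
    refine hk ?_
    simp only [Finset.coe_range, Set.mem_Iio, not_lt] at hlt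
    change -(Ring.choose (n + (k + 1)) (k + 1) • (A.coeff (n + (k + 1)) * iter δ k y)) = 0
    rw [hA _ (by omega), zero_mul, smul_zero, neg_zero]
  -- Chosen so that `N + K > M`: all coefficients of `B` from index `N + K` on vanish.
  set K : ℕ := (M + 1 - N).toNat with hK
  have hB : OrderLE B M := hM
  have hB1 : OrderLE (dPow 1 B) (1 + M) := by
    have := (monomial_orderLE (δ := δ) 1 1).mul hB
    rwa [monomial_one_mul] at this
  rw [coeff_add, dPow_one_coeff, monomial_zero_mul_coeff,
    key (dPow 1 B) N K (hB1.mono (by omega)), key B (N - 1) (K + 1) (hB.mono (by push_cast; omega)),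
    key B N K (hB.mono (by omega)), Finset.sum_range_succ', map_sum]
  -- Shift the index by one: the new top term is zero by the choice of `K`. The bottom term `(N + 1)
  -- b_N y` exceeds its counterpart `N b_N y` in coefficient `N - 1` of `adLogX y B` by the term
  -- `b_N y` due to `[ln x, ∂] = -y`.
  have hg : ∑ k ∈ Finset.range K, Ring.choose (N + (k + 1)) (k + 1) •
      (B.coeff (N + k) * iter δ k y) =
      ∑ k ∈ Finset.range K, Ring.choose (N + (k + 1) + 1) (k + 1 + 1) •
        (B.coeff (N + (k + 1)) * iter δ (k + 1) y) + (N + 1) • (B.coeff N * y) := by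
    have h := Finset.sum_range_succ (fun k : ℕ => Ring.choose (N + (k + 1)) (k + 1) •
      (B.coeff (N + k) * iter δ k y)) K
    rw [hM (N + K) (by omega), zero_mul, smul_zero, add_zero, Finset.sum_range_succ'] at h
    rw [← h]
    simp [iter, add_assoc]
  have h1 : ∀ k : ℕ, -(Ring.choose (N + (k + 1)) (k + 1) •
      ((dPow 1 B).coeff (N + (k + 1)) * iter δ k y)) =
      -(Ring.choose (N + (k + 1)) (k + 1) • (B.coeff (N + k) * iter δ k y)) -
        Ring.choose (N + (k + 1)) (k + 1) • (δ (B.coeff (N + (k + 1))) * iter δ k y) :=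
    fun k => by
      rw [dPow_one_coeff, show N + ((k : ℤ) + 1) - 1 = N + k by ring, add_mul, smul_add]
      abel
  have h2 : ∀ k : ℕ, δ (-(Ring.choose (N + (k + 1)) (k + 1) •
      (B.coeff (N + (k + 1)) * iter δ k y))) =
      -(Ring.choose (N + (k + 1)) (k + 1) • (B.coeff (N + (k + 1)) * iter δ (k + 1) y)) -
        Ring.choose (N + (k + 1)) (k + 1) • (δ (B.coeff (N + (k + 1))) * iter δ k y) :=
    fun k => by
      rw [map_neg, map_zsmul, Derivation.leibniz, iter_succ, smul_add, smul_eq_mul, smul_eq_mul,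
        mul_comm (iter δ k y)]
      abel
  have h3 : ∀ k : ℕ, -(Ring.choose (N - 1 + ((k + 1 : ℕ) + 1)) (k + 1 + 1) •
      (B.coeff (N - 1 + ((k + 1 : ℕ) + 1)) * iter δ (k + 1) y)) =
      -(Ring.choose (N + (k + 1) + 1) (k + 1 + 1) •
        (B.coeff (N + (k + 1)) * iter δ (k + 1) y)) +
      Ring.choose (N + (k + 1)) (k + 1) • (B.coeff (N + (k + 1)) * iter δ (k + 1) y) :=
    fun k => by
      rw [Ring.choose_succ_succ, add_smul,
        show N - 1 + (((k + 1 : ℕ) : ℤ) + 1) = N + (k + 1) by push_cast; ring]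
      abel
  simp only [h1, h2, h3, Finset.sum_sub_distrib, Finset.sum_add_distrib, Finset.sum_neg_distrib, hg]
  simp [iter]
  ring

theorem adLogX_mul (y : R) (A B : PsiDO δ) :
    adLogX y (A * B) = adLogX y A * B + A * adLogX y B := by
  refine leibniz_of_generators (-1) (fun _ _ => adLogX_orderLE y) (adLogX_monomial_zero y 1)
    (fun a B => ?_) (fun B => ?_) A B
  · rw [adLogX_monomial_zero, zero_mul, zero_add, adLogX_function_mul]
  · rw [monomial_one_mul, monomial_one_mul, adLogX_dPow_one, adLogX_monomial_one_one]

end PsiDO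

namespace PsiDO

variable {R : Type*} [CommRing R] [Algebra ℂ R] {δ : Derivation ℂ R R}

/-! ### The commutator of `ad (ln ∂)` and `ad (ln x)` -/

variable (δ) in
/-- The operator `[ln ∂, ln x] = ∑_{n ≥ 1} ((-1)^{n-1} / n) δⁿ⁻¹(y) ∂⁻ⁿ`, where `y = δ (ln x)`. -/
def commLog (y : R) : PsiDO δ := negOp fun j => ((-1 : ℂ) ^ j / ((j : ℂ) + 1)) • iter δ j y

theorem adLogD_adLogX_monomial_one_one (y : R) :
    adLogD (adLogX y (monomial 1 1 : PsiDO δ)) - adLogX y (adLogD (monomial 1 1)) =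
      commLog δ y * monomial 1 1 - monomial 1 1 * commLog δ y := by
  rw [adLogX_monomial_one_one, adLogD_monomial_one, map_zero, sub_zero, adLogD_monomial_zero]
  ext N
  rw [coeff_sub, mul_monomial_one_coeff, monomial_one_mul, dPow_one_coeff, sub_add_cancel_left]
  cases N with
  | ofNat k => simp [negOp_coeff_natCast, commLog]
  | negSucc k =>
    rw [commLog, negOp_coeff_negSucc, negOp_coeff_negSucc, Derivation.map_smul, map_neg, smul_neg,
      iter_succ]

theorem adLogX_negOp (y : R) (f : ℕ → R) : adLogX y (negOp f : PsiDO δ) =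
    negOp fun n => -∑ j ∈ Finset.range n,
      Ring.choose (Int.negSucc (n - 1 - j)) (j + 1) • (f (n - 1 - j) * iter δ j y) := by
  refine eq_negOp ((adLogX_orderLE y (negOp_orderLE f)).mono (by omega)) fun n => ?_
  rw [adLogX_coeff, finsum_eq_sum_of_support_subset (s := Finset.range n),
    Finset.sum_neg_distrib]
  · refine congrArg Neg.neg (Finset.sum_congr rfl fun j hj => ?_)
    have hj' := Finset.mem_range.mp hj
    rw [show Int.negSucc n + ((j : ℤ) + 1) = Int.negSucc (n - 1 - j) by omega,
      negOp_coeff_negSucc]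
  · intro j hj
    by_contra hlt
    refine hj ?_
    simp only [Finset.coe_range, Set.mem_Iio, not_lt] at hlt
    change -(_ • (_ * _)) = (0 : R)
    rw [negOp_orderLE f _ (by omega), zero_mul, smul_zero, neg_zero]

/-- Since `ln x` commutes with functions, only `-[ln x, [ln ∂, a]]` survives. The term of `commLog δ
y * a` with no derivative on `a` cancels against `a * commLog δ y`. -/
theorem adLogD_adLogX_monomial_zero (y a : R) :
    adLogD (adLogX y (monomial a 0 : PsiDO δ)) - adLogX y (adLogD (monomial a 0)) =
      commLog δ y * monomial a 0 - monomial a 0 * commLog δ y := by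
  rw [adLogX_monomial_zero, map_zero, zero_sub, adLogD_monomial_zero, adLogX_negOp, commLog,
    negOp_mul_monomial_zero, monomial_zero_mul_negOp]
  ext N
  cases N with
  | ofNat k =>
    simp only [coeff_sub, coeff_neg, Int.ofNat_eq_natCast, negOp_coeff_natCast, neg_zero, sub_zero]
  | negSucc n =>
    simp only [coeff_sub, coeff_neg, negOp_coeff_negSucc, neg_neg, Finset.sum_range_succ,
      Nat.sub_self, Ring.choose_zero_right, one_smul]
    rw [show iter δ 0 a = a by simp [iter], mul_comm a, add_sub_cancel_right]
    refine Finset.sum_congr rfl fun q hq => ?_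
    obtain ⟨p, rfl⟩ := Nat.exists_eq_add_of_lt (Finset.mem_range.mp hq)
    -- The two coefficients of `δᵖ⁺¹(a) δ^q(y)` agree because the binomials choosing `p + 1` or `q +
    -- 1` from `p + q + 2` are equal.
    have h1 := choose_negSucc_mul p (q + 1)
    have h2 := choose_negSucc_mul q (p + 1)
    have h3 : (p + (q + 1) + 1).choose (q + 1) = (q + (p + 1) + 1).choose (p + 1) := by
      rw [show q + (p + 1) + 1 = p + (q + 1) + 1 by ring]
      exact Nat.choose_symm_of_eq_add (by ring)
    rw [h3, show p + (q + 1) = q + (p + 1) by ring,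
      show (p : ℂ) + (q + 1 : ℕ) = q + (p + 1 : ℕ) by push_cast; ring] at h1
    have h := h1.trans h2.symm
    rw [show q + p + 1 - 1 - q = p by omega, show q + p + 1 - q = p + 1 by omega,
      ← Int.cast_smul_eq_zsmul ℂ, ← Int.cast_smul_eq_zsmul ℂ, smul_mul_assoc, smul_mul_smul_comm,
      ← h, smul_smul, mul_comm (iter δ q y), mul_comm ((Ring.choose _ _ : ℤ) : ℂ)]

theorem adLogD_adLogX (y : R) (A : PsiDO δ) :
    adLogD (adLogX y A) - adLogX y (adLogD A) = commLog δ y * A - A * commLog δ y := by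
  let F : PsiDO δ →ₗ[ℂ] PsiDO δ := adLogD ∘ₗ adLogX y - adLogX y ∘ₗ adLogD -
    (LinearMap.mulLeft ℂ (commLog δ y) - LinearMap.mulRight ℂ (commLog δ y))
  refine sub_eq_zero.mp (eq_zero_of_generators (D := F) (-1) (fun A M hA => ?_) (fun A B => ?_)
    (fun a => sub_eq_zero.mpr (adLogD_adLogX_monomial_zero y a))
    (sub_eq_zero.mpr (adLogD_adLogX_monomial_one_one y)) A)
  · have e1 := adLogD_orderLE (adLogX_orderLE y hA)
    have e2 := adLogX_orderLE y (adLogD_orderLE hA)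
    have hQ : OrderLE (commLog δ y) (-1) := negOp_orderLE _
    exact ((e1.mono (by omega)).sub (e2.mono (by omega))).sub
      (((hQ.mul hA).mono (by omega)).sub ((hA.mul hQ).mono (by omega)))
  · simp only [F, LinearMap.sub_apply, LinearMap.comp_apply, LinearMap.mulLeft_apply,
      LinearMap.mulRight_apply, adLogX_mul, adLogD_mul, map_add]
    noncomm_ring

end PsiDO

/-! ### Powers of `x`, the residue and integration by parts on the circle. -/

namespace CircleFun

theorem xPow_mul (m n : ℤ) : xPow m * xPow n = xPow (m + n) := by
  ext θ
  change Complex.exp _ * Complex.exp _ = Complex.exp _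
  rw [← Complex.exp_add]
  push_cast
  ring_nf

theorem xPow_zero : xPow 0 = 1 := by
  ext θ
  change Complex.exp _ = 1
  simp

theorem xPow_neg_one_mul_apply (θ : ℝ) : (xPow (-1)).1 θ * (xPow 1).1 θ = 1 := by
  have h : xPow (-1) * xPow 1 = 1 := by rw [xPow_mul]; exact xPow_zero
  exact congrFun (congrArg Subtype.val h) θ

theorem ddx_xPow (n : ℤ) : ddx (xPow n) = (n : ℂ) • xPow (n - 1) := by
  ext θ
  change -Complex.I * (xPow (-1)).1 θ * deriv (xPow n).1 θ = n * (xPow (n - 1)).1 θ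
  have h : HasDerivAt (xPow n).1 (Complex.exp (n * (θ * Complex.I)) * (n * (1 * Complex.I))) θ :=
    (((Complex.ofRealCLM.hasDerivAt (x := θ)).mul_const Complex.I).const_mul (n : ℂ)).cexp
  rw [h.deriv]
  have e : (xPow (-1)).1 θ * (xPow n).1 θ = (xPow (n - 1)).1 θ := by
    rw [show n - 1 = -1 + n by ring, ← xPow_mul]
    rfl
  rw [← e]
  change _ = (n : ℂ) * (_ * Complex.exp (n * (θ * Complex.I)))
  linear_combination (-(n : ℂ) * (xPow (-1)).1 θ * Complex.exp (n * (θ * Complex.I))) *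
    Complex.I_mul_I

theorem iter_ddx_xPow_neg_one (j : ℕ) : PsiDO.iter ddx j (xPow (-1)) =
    ((-1 : ℂ) ^ j * j.factorial) • xPow (Int.negSucc j) := by
  induction j with
  | zero => simp [PsiDO.iter]
  | succ j ih =>
    rw [PsiDO.iter_succ, ih, Derivation.map_smul, ddx_xPow, smul_smul]
    congr 1
    · rw [Nat.factorial_succ, Int.cast_negSucc]
      push_cast
      ring

/-- The factor `x⁻¹` in `d/dx` cancels the `x` from `dx = i x dθ`, leaving the integral of `df/dθ`
over a period. -/
theorem res_ddx (f : CircleFun) : res (ddx f) = 0 := by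
  have h : ∀ θ : ℝ, (ddx f).1 θ * (xPow 1).1 θ = -Complex.I * deriv f.1 θ := fun θ => by
    change -Complex.I * (xPow (-1)).1 θ * deriv f.1 θ * (xPow 1).1 θ = _
    linear_combination (-Complex.I * deriv f.1 θ) * xPow_neg_one_mul_apply θ
  change (1 / (2 * Real.pi) : ℂ) * ∫ θ in (0 : ℝ)..(2 * Real.pi),
    (ddx f).1 θ * (xPow 1).1 θ = 0
  simp only [h]
  rw [intervalIntegral.integral_const_mul, intervalIntegral.integral_deriv_eq_sub
    (fun θ _ => (f.2.1.differentiable (by simp)) θ)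
    ((contDiff_infty_iff_deriv.mp f.2.1).2.continuous.intervalIntegrable _ _)]
  have := f.2.2 0
  rw [zero_add] at this
  rw [this, sub_self, mul_zero, mul_zero]

theorem res_mul_iter (a b : CircleFun) (k : ℕ) : res (a * PsiDO.iter ddx k b) =
    (-1) ^ k * res (PsiDO.iter ddx k a * b) := by
  induction k generalizing a with
  | zero => simp [PsiDO.iter]
  | succ k ih =>
    have h := res_ddx (a * PsiDO.iter ddx k b)
    rw [Derivation.leibniz, map_add, smul_eq_mul, smul_eq_mul, mul_comm (PsiDO.iter ddx k b)] at h
    rw [PsiDO.iter_succ, PsiDO.iter_succ', pow_succ, eq_neg_of_add_eq_zero_left h, ih]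
    ring

theorem res_xPow_neg_one : res (xPow (-1)) = 1 := by
  change (1 / (2 * Real.pi) : ℂ) * ∫ θ in (0 : ℝ)..(2 * Real.pi),
    (xPow (-1)).1 θ * (xPow 1).1 θ = 1
  simp only [xPow_neg_one_mul_apply]
  rw [intervalIntegral.integral_const, sub_zero, Complex.real_smul, mul_one]
  have : (Real.pi : ℂ) ≠ 0 := by exact_mod_cast Real.pi_ne_zero
  push_cast
  field_simp

end CircleFun

/-! ### The residue as a trace invariant under both derivations. -/

namespace PsiDif

open PsiDO

/-- The sign `(-1)ʲ` in the logarithm series cancels the one in `δʲ(x⁻¹) = (-1)ʲ j! x⁻ʲ⁻¹`. -/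
theorem Q_eq_commLog : Q = commLog CircleFun.ddx (CircleFun.xPow (-1)) := by
  refine eq_negOp (fun n hn => if_neg (by omega)) fun k => ?_
  rw [CircleFun.iter_ddx_xPow_neg_one, smul_smul]
  change (if Int.negSucc k < 0 then (((Int.negSucc k).natAbs - 1).factorial /
    ((Int.negSucc k).natAbs : ℂ)) • CircleFun.xPow (Int.negSucc k) else 0) = _
  rw [if_pos (by omega), Int.natAbs_negSucc, Nat.succ_eq_add_one, Nat.add_sub_cancel]
  congr 1
  have : (-1 : ℂ) ^ k * (-1) ^ k = 1 := by rw [← mul_pow]; simp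
  push_cast
  linear_combination -((k.factorial : ℂ) / (k + 1)) * this

theorem D_mul (i : Fin 2) (A B : PsiDif) : D i (A * B) = D i A * B + A * D i B := by
  fin_cases i
  · exact adLogD_mul A B
  · exact adLogX_mul _ A B

theorem D_comm (A : PsiDif) : D 0 (D 1 A) - D 1 (D 0 A) = Q * A - A * Q := by
  rw [Q_eq_commLog]
  exact adLogD_adLogX _ A

/-- For `D 0`, the coefficients of `[ln ∂, a ∂ᵐ]` are derivatives, which have no residue. For `D 1`,
the `∂⁻¹` coefficient of `[ln x, a ∂ᵏ]` carries the factor `(k choose k+1) = 0`. -/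
theorem Tr_D (i : Fin 2) (A : PsiDif) : Tr (D i A) = 0 := by
  refine monomial_induction (G := Tr ∘ₗ D i) (-1) (fun A hA => ?_) (fun a m => ?_) A
  · have h : OrderLE (D i A) (-1 + -1) := by
      fin_cases i
      · exact adLogD_orderLE hA
      · exact adLogX_orderLE _ hA
    change CircleFun.res ((D i A).coeff (-1)) = 0
    rw [h _ (by omega), map_zero]
  · change CircleFun.res ((D i (monomial a m)).coeff (-1)) = 0
    fin_cases i
    · change CircleFun.res ((adLogD (monomial a m)).coeff (-1)) = 0
      rw [monomial_eq_mul, adLogD_mul_monomial_one, mul_monomial_one_coeff, adLogD_monomial_zero]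
      cases -1 - m with
      | ofNat k => exact map_zero _
      | negSucc k =>
        rw [negOp_coeff_negSucc, map_smul, iter_succ, CircleFun.res_ddx, smul_zero]
    · change CircleFun.res ((adLogX _ (monomial a m)).coeff (-1)) = 0
      rw [adLogX_coeff, finsum_eq_zero_of_forall_eq_zero, map_zero]
      intro k
      rw [show (-1 : ℤ) + (k + 1) = k by ring, Ring.choose_natCast,
        Nat.choose_eq_zero_of_lt k.lt_succ_self, Nat.cast_zero, zero_smul, neg_zero]

/-- With `k = m + n + 1`, integration by parts moves `k` derivatives from `b` to `a` at the cost of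
`(-1)ᵏ`, the same sign that upper negation gives in passing from `(m choose k)` to `(n choose k)`.
-/
theorem Tr_monomial_mul_monomial (a b : CircleFun) (m n : ℤ) :
    Tr (monomial a m * monomial b n) = Tr (monomial b n * monomial a m) := by
  change CircleFun.res ((monomial a m * monomial b n : PsiDif).coeff (-1)) =
    CircleFun.res ((monomial b n * monomial a m : PsiDif).coeff (-1))
  rcases lt_or_ge (m + n) (-1) with h | h
  · rw [(monomial_orderLE a m).mul (monomial_orderLE b n) _ h,
      (monomial_orderLE b n).mul (monomial_orderLE a m) _ (by omega)]
  · obtain ⟨k, hk⟩ := Int.eq_ofNat_of_zero_le (show 0 ≤ m + n + 1 by omega)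
    have h1 : (dPow m (monomial b n : PsiDif)).coeff (-1) =
        Ring.choose m k • iter CircleFun.ddx k b := by
      rw [← dPow_monomial_coeff m b n k]
      congr 1
      omega
    have h2 : (dPow n (monomial a m : PsiDif)).coeff (-1) =
        Ring.choose n k • iter CircleFun.ddx k a := by
      rw [← dPow_monomial_coeff n a m k]
      congr 1
      omega
    rw [monomial_mul_coeff, monomial_mul_coeff, h1, h2, mul_smul_comm, mul_smul_comm,
      show n = k - 1 - m by omega, choose_neg_eq, map_zsmul, map_zsmul, CircleFun.res_mul_iter,
      mul_comm b]
    simp only [zsmul_eq_mul]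
    push_cast
    ring

theorem Tr_mul_comm (A B : PsiDif) : Tr (A * B) = Tr (B * A) := by
  have key : ∀ C : PsiDif, ∃ L, ∀ A, OrderLE A L →
      (Tr ∘ₗ LinearMap.mulRight ℂ C - Tr ∘ₗ LinearMap.mulLeft ℂ C) A = 0 := fun C => by
    obtain ⟨M, hM⟩ : ∃ M, OrderLE C M := C.bdd
    -- Both products then have order at most `-2`, hence no `∂⁻¹` term.
    refine ⟨-2 - M, fun A hA => ?_⟩
    change CircleFun.res ((A * C).coeff (-1)) - CircleFun.res ((C * A).coeff (-1)) = 0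
    rw [(hA.mul hM) _ (by omega), (hM.mul hA) _ (by omega), sub_self]
  have h1 : ∀ (b : CircleFun) (n : ℤ) (A : PsiDif),
      Tr (A * monomial b n) = Tr (monomial b n * A) := fun b n A => by
    obtain ⟨L, hL⟩ := key (monomial b n)
    exact sub_eq_zero.mp (monomial_induction L hL
      (fun a m => sub_eq_zero.mpr (Tr_monomial_mul_monomial a b m n)) A)
  obtain ⟨L, hL⟩ := key B
  exact sub_eq_zero.mp (monomial_induction L hL (fun a m => sub_eq_zero.mpr (h1 a m B).symm) A)

end PsiDif

/-! ### Signed sums over permutations -/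

section Alternation

variable {V : Type*}

/-- The signed sum of `g` over all orderings of two arguments. -/
def altSum2 (g : V → V → ℂ) (a b : V) : ℂ := g a b - g b a

/-- The signed sum of `g` over all orderings of three arguments. -/
def altSum3 (g : V → V → V → ℂ) (a b c : V) : ℂ :=
  altSum2 (g a) b c - altSum2 (g b) a c + altSum2 (g c) a b

/-- The signed sum of `g` over all orderings of four arguments. -/
def altSum4 (g : V → V → V → V → ℂ) (a b c d : V) : ℂ :=
  altSum3 (g a) b c d - altSum3 (g b) a c d + altSum3 (g c) a b d - altSum3 (g d) a b c

theorem sum_perm_succ {n : ℕ} (f : Equiv.Perm (Fin (n + 1)) → ℂ) :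
    ∑ σ, f σ = ∑ p, ∑ σ, f (Equiv.Perm.decomposeFin.symm (p, σ)) := by
  rw [← Fintype.sum_prod_type', ← Equiv.sum_comp Equiv.Perm.decomposeFin.symm]

theorem sum_perm_eq_altSum2 (g : V → V → ℂ) (v : Fin 2 → V) :
    ∑ σ : Equiv.Perm (Fin 2), Equiv.Perm.sign σ • g (v (σ 0)) (v (σ 1)) =
      altSum2 g (v 0) (v 1) := by
  rw [sum_perm_succ, Fin.sum_univ_two]
  simp [altSum2, Units.smul_def, sub_eq_add_neg]

theorem sum_perm_eq_altSum3 (g : V → V → V → ℂ) (v : Fin 3 → V) :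
    ∑ σ : Equiv.Perm (Fin 3), Equiv.Perm.sign σ • g (v (σ 0)) (v (σ 1)) (v (σ 2)) =
      altSum3 g (v 0) (v 1) (v 2) := by
  have h1 : ∀ (p : Fin 3) (τ : Equiv.Perm (Fin 2)), Equiv.Perm.decomposeFin.symm (p, τ) 2 =
      Equiv.swap 0 p (τ 1).succ := fun p τ => Equiv.Perm.decomposeFin_symm_apply_succ τ p 1
  have h2 : Equiv.swap (0 : Fin 3) 1 2 = 2 := by decide
  have h3 : Equiv.swap (0 : Fin 3) 2 1 = 1 := by decide
  rw [sum_perm_succ, Fin.sum_univ_three, sum_perm_succ, sum_perm_succ, sum_perm_succ]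
  simp [Fin.sum_univ_two, h1, h2, h3, altSum3, altSum2, Units.smul_def]
  ring

/-- Each slot of `g` receives a commutator, and alternation merges its two halves into one product.
The middle sign is negative because bringing the bracket to the front is odd among three arguments,
whereas moving its two letters is even among four. The factor `1/2` compensates for counting each
pair twice. -/
theorem ceDifferential_eq_altSum4 {R : Type*} [CommRing R] [Algebra ℂ R]
    {δ : Derivation ℂ R R} (φ : PsiDO δ [⋀^Fin 3]→ₗ[ℂ] ℂ) (g : PsiDO δ → PsiDO δ → PsiDO δ → ℂ)
    (hφ : ∀ v, φ v = altSum3 g (v 0) (v 1) (v 2))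
    (h1 : ∀ a a' b c, g (a - a') b c = g a b c - g a' b c)
    (h2 : ∀ a b b' c, g a (b - b') c = g a b c - g a b' c)
    (h3 : ∀ a b c c', g a b (c - c') = g a b c - g a b c') (A : Fin 4 → PsiDO δ) :
    ceDifferential φ A =
      altSum4 (fun a b c d => g (a * b) c d - g a (b * c) d + g a b (c * d))
        (A 0) (A 1) (A 2) (A 3) := by
  simp only [ceDifferential, hφ, Fin.sum_univ_succ, Fin.removeNth, Function.update, Fin.succAbove]
  simp [Ring.lie_def, altSum4, altSum3, altSum2, h1, h2, h3]
  ring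

end Alternation

/-! ### The cocycle `Ψ₃` -/

/-- Under alternation a shift by one changes the sign and a shift by two does not. So the `r` terms
of the hypothesis cancel, the others double, and it becomes `2(q + w - u) = 0`; the target
alternates to `q + w - u`. -/
theorem altSum4_eq_zero {V : Type*} (q r u w : V → V → V → V → ℂ)
    (h : ∀ a b c d, q a b c d - q b c d a + w a b c d - w d a b c + r a b c d - r c d a b +
      u d a b c - u a b c d = 0) (a b c d : V) :
    altSum4 (fun a b c d => u b c d a - w b c d a + q a b c d) a b c d = 0 := by
  have key : altSum4 (fun a b c d => q a b c d - q b c d a + w a b c d - w d a b c + r a b c d -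
      r c d a b + u d a b c - u a b c d) a b c d = 0 := by
    simp only [h, altSum4, altSum3, altSum2, sub_zero, add_zero]
  simp only [altSum4, altSum3, altSum2] at key ⊢
  linear_combination key / 2

namespace PsiDif

/-- The trilinear form whose signed sum over all orderings is `Ψ₃`. -/
def psiForm (a b c : PsiDif) : ℂ :=
  Tr (D 0 a * D 1 b * c) - Tr (D 1 a * D 0 b * c) + Tr (Q * a * b * c)

theorem Psi3_eq_altSum3 (v : Fin 3 → PsiDif) : Psi3 v = altSum3 psiForm (v 0) (v 1) (v 2) := by
  rw [Psi3_apply, ← sum_perm_eq_altSum3, ← Finset.sum_add_distrib]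
  refine Finset.sum_congr rfl fun σ _ => ?_
  have h := sum_perm_eq_altSum2 (fun i j => Tr (D i (v (σ 0)) * D j (v (σ 1)) * v (σ 2))) id
  simp only [id] at h
  rw [h, ← smul_add]
  rfl

theorem isCocycle_Psi3 : IsCocycle Psi3 := fun A => by
  rw [ceDifferential_eq_altSum4 Psi3 psiForm Psi3_eq_altSum3
    (fun a a' b c => by simp only [psiForm, map_sub, sub_mul, mul_sub]; ring)
    (fun a b b' c => by simp only [psiForm, map_sub, sub_mul, mul_sub]; ring)
    (fun a b c c' => by simp only [psiForm, map_sub, mul_sub]; ring)]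
  -- By the Leibniz rule, terms with a derivation on `a` cancel in pairs; cyclicity moves the
  -- remaining plain `a` to the end.
  have e : (fun a b c d : PsiDif => psiForm (a * b) c d - psiForm a (b * c) d +
      psiForm a b (c * d)) = fun a b c d => Tr (D 0 b * D 1 c * d * a) -
        Tr (D 1 b * D 0 c * d * a) + Tr (Q * a * b * c * d) := by
    funext a b c d
    rw [Tr_mul_comm _ a, Tr_mul_comm _ a]
    simp only [psiForm, D_mul, add_mul, mul_add, map_add, mul_assoc]
    ring
  rw [e]
  refine altSum4_eq_zero (fun a b c d => Tr (Q * a * b * c * d))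
    (fun a b c d => Tr (D 1 a * b * D 0 c * d)) (fun a b c d => Tr (D 0 a * D 1 b * c * d))
    (fun a b c d => Tr (D 1 a * D 0 b * c * d)) (fun a b c d => ?_) _ _ _ _
  -- In the difference of these two identities the second-order terms form a commutator on `a`,
  -- which `hQ` trades for `Q`; cyclicity turns the rest into shifts of `u`, `w` and `r`.
  have h0 := Tr_D 0 (D 1 a * b * c * d)
  have h1 := Tr_D 1 (D 0 a * b * c * d)
  have hQ : Tr (D 0 (D 1 a) * b * c * d) - Tr (D 1 (D 0 a) * b * c * d) =
      Tr (Q * a * b * c * d) - Tr (Q * b * c * d * a) := by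
    rw [← map_sub, ← sub_mul, ← sub_mul, ← sub_mul, D_comm, Tr_mul_comm _ a, ← map_sub]
    congr 1
    noncomm_ring
  have hu : Tr (D 0 d * D 1 a * b * c) = Tr (D 1 a * b * c * D 0 d) := by
    rw [Tr_mul_comm _ (D 0 d)]; simp only [mul_assoc]
  have hw : Tr (D 1 d * D 0 a * b * c) = Tr (D 0 a * b * c * D 1 d) := by
    rw [Tr_mul_comm _ (D 1 d)]; simp only [mul_assoc]
  have hr : Tr (D 1 c * d * D 0 a * b) = Tr (D 0 a * b * D 1 c * d) := by
    rw [mul_assoc _ (D 0 a), Tr_mul_comm]; simp only [mul_assoc]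
  simp only [D_mul, add_mul, map_add] at h0 h1
  rw [hu, hw, hr]
  linear_combination h0 - h1 - hQ

/-! ### Nontriviality -/

open PsiDO

theorem D_one (i : Fin 2) : D i 1 = 0 := by
  fin_cases i
  · exact adLogD_monomial_one 0
  · exact adLogX_monomial_zero _ 1

theorem D_zero_d : D 0 d = 0 := adLogD_monomial_one 1

theorem D_one_x : D 1 x = 0 := adLogX_monomial_zero _ _

theorem D_one_d : D 1 d = -monomial (CircleFun.xPow (-1)) 0 := by
  refine (adLogX_monomial_one_one _).trans ?_
  ext1 n
  rw [coeff_neg, coeff_monomial, coeff_monomial]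
  split_ifs <;> simp

theorem D_zero_x : D 0 x = monomial 1 (-1) := by
  refine (adLogD_monomial_zero _).trans (eq_negOp (monomial_orderLE _ _) fun k => ?_).symm
  have h1 : CircleFun.ddx (CircleFun.xPow 1) = 1 := by
    rw [CircleFun.ddx_xPow]
    simpa using CircleFun.xPow_zero
  rw [coeff_monomial, iter_succ', h1]
  cases k with
  | zero => simp [iter]
  | succ k => rw [iter_succ', Derivation.map_one_eq_zero, map_zero, smul_zero, if_neg (by omega)]

theorem x_mul_d : x * d = d * x - 1 := by
  ext1 n
  have h1 : CircleFun.ddx (CircleFun.xPow 1) = 1 := by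
    rw [CircleFun.ddx_xPow]
    simpa using CircleFun.xPow_zero
  rw [coeff_sub, x, d, mul_monomial_one_coeff, monomial_one_mul, dPow_one_coeff, one_coeff,
    coeff_monomial, coeff_monomial, apply_ite CircleFun.ddx, h1, map_zero, add_sub_cancel_right]

theorem Tr_Q : Tr Q = 1 := by
  change CircleFun.res (Q.coeff (-1)) = 1
  rw [Q_eq_commLog, commLog, show (-1 : ℤ) = Int.negSucc 0 from rfl, negOp_coeff_negSucc]
  simpa [iter] using CircleFun.res_xPow_neg_one

theorem Tr_D_zero_x_mul_D_one_d : Tr (D 0 x * D 1 d) = -1 := by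
  rw [D_zero_x, D_one_d, mul_neg, map_neg, Tr_mul_comm]
  change -CircleFun.res ((monomial _ 0 * monomial 1 (-1) : PsiDif).coeff (-1)) = -1
  rw [← monomial_eq_mul, coeff_monomial, if_pos rfl, CircleFun.res_xPow_neg_one]

/-- A derivation term survives only with `1` in the last slot, and the two that do contribute `-1`
each. As `1` is central, the six `Q` terms collapse to `Tr(Q [x, ∂]) = -Tr Q = -1`. -/
theorem Psi3_one_x_d : Psi3 ![1, x, d] = -3 := by
  have h : Tr (Q * x * d) - Tr (Q * d * x) = -1 := by
    rw [mul_assoc, x_mul_d, mul_sub, mul_one, ← mul_assoc, map_sub, Tr_Q]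
    ring
  have h2 : Tr (D 1 d * D 0 x) = -1 := (Tr_mul_comm _ _).trans Tr_D_zero_x_mul_D_one_d
  rw [Psi3_eq_altSum3]
  simp only [altSum3, altSum2, psiForm, Matrix.cons_val_zero, Matrix.cons_val_one, Matrix.cons_val,
    D_one, D_zero_d, D_one_x, zero_mul, mul_zero, map_zero, mul_one,
    Tr_D_zero_x_mul_D_one_d, h2]
  linear_combination h

end PsiDif

/-! ### Heisenberg triples as cycles. -/

section Heisenberg

variable {L : Type*} [LieRing L] [LieAlgebra ℂ L] {a b c : L}

/-- Every bracket is zero or is `±a` placed beside another `a`. The target `N` is arbitrary so that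
the lemma covers scalar cochains as well as the universal alternating map into the exterior algebra.
-/
theorem map_update_lie_eq_zero {N : Type*} [AddCommGroup N] [Module ℂ N]
    (φ : L [⋀^Fin 2]→ₗ[ℂ] N) (hab : ⁅a, b⁆ = 0) (hac : ⁅a, c⁆ = 0) (hbc : ⁅b, c⁆ = -a)
    (i : Fin 3) (j : Fin 2) : φ (Function.update (i.removeNth ![a, b, c]) j
      ⁅(![a, b, c] : Fin 3 → L) i, i.removeNth ![a, b, c] j⁆) = 0 := by
  have hba : ⁅b, a⁆ = 0 := by rw [← lie_skew, hab, neg_zero]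
  have hca : ⁅c, a⁆ = 0 := by rw [← lie_skew, hac, neg_zero]
  have hcb : ⁅c, b⁆ = a := by rw [← lie_skew, hbc, neg_neg]
  have h1 : φ (Function.update ![a, c] 1 (-a)) = 0 := by
    rw [φ.map_update_neg, φ.map_eq_zero_of_eq _ (i := 0) (j := 1) rfl (by decide), neg_zero]
  fin_cases i <;> fin_cases j
  · exact φ.map_coord_zero 0 hab
  · exact φ.map_coord_zero 1 hac
  · exact φ.map_coord_zero 0 hba
  · rw [← h1]
    refine congrArg φ (funext fun k => ?_)
    fin_cases k
    · rfl
    · exact hbc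
  · exact φ.map_coord_zero 0 hca
  · exact φ.map_eq_zero_of_eq _ (i := 0) (j := 1) hcb.symm (by decide)

theorem not_isCoboundary_of_heisenberg (ψ : L [⋀^Fin 3]→ₗ[ℂ] ℂ) (hab : ⁅a, b⁆ = 0)
    (hac : ⁅a, c⁆ = 0) (hbc : ⁅b, c⁆ = -a) (hψ : ψ ![a, b, c] ≠ 0) : ¬ IsCoboundary ψ := by
  rintro ⟨φ, hφ⟩
  refine hψ ?_
  rw [← hφ, ceDifferential]
  simp only [map_update_lie_eq_zero φ hab hac hbc, Finset.sum_const_zero, mul_zero]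

theorem ceBoundary_heisenberg (hab : ⁅a, b⁆ = 0) (hac : ⁅a, c⁆ = 0) (hbc : ⁅b, c⁆ = -a) :
    ceBoundary ![a, b, c] = 0 := by
  rw [ceBoundary]
  simp only [map_update_lie_eq_zero _ hab hac hbc, Finset.sum_const_zero, smul_zero]

end Heisenberg

/-! ### Restriction to intermediate Lie algebras. -/

namespace PsiDif

theorem lie_x_d : ⁅x, d⁆ = -(1 : PsiDif) := by
  rw [Ring.lie_def, x_mul_d]
  abel

theorem one_lie (A : PsiDif) : ⁅(1 : PsiDif), A⁆ = 0 := by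
  rw [Ring.lie_def, one_mul, mul_one, sub_self]

/-- The hypothesis serves to place `1`, `x` and `∂` in `𝔤`, so the same Heisenberg triple detects
the class there. -/
theorem not_isCoboundary_restrict {𝔤 : LieSubalgebra ℂ PsiDif} (h : Dif1 ≤ 𝔤) :
    ¬ IsCoboundary (restrictCochain 𝔤 Psi3) := by
  have h1 : ∀ B : 𝔤, ⁅(⟨1, h oneDif.2⟩ : 𝔤), B⁆ = 0 := fun B => Subtype.ext (one_lie B)
  have h2 : ⁅(⟨x, h xDif.2⟩ : 𝔤), (⟨d, h dDif.2⟩ : 𝔤)⁆ = -⟨1, h oneDif.2⟩ :=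
    Subtype.ext lie_x_d
  refine not_isCoboundary_of_heisenberg _ (h1 _) (h1 _) h2 ?_
  have e : restrictCochain 𝔤 Psi3 ![⟨1, h oneDif.2⟩, ⟨x, h xDif.2⟩, ⟨d, h dDif.2⟩] =
      Psi3 ![1, x, d] := by
    refine congrArg Psi3 (funext fun i => ?_)
    fin_cases i <;> rfl
  rw [e, Psi3_one_x_d]
  norm_num

/-- The differential is built from brackets, which the inclusion preserves. -/
theorem isCocycle_restrict {L : Type*} [LieRing L] [LieAlgebra ℂ L] {n : ℕ}
    {φ : L [⋀^Fin n]→ₗ[ℂ] ℂ} (hφ : IsCocycle φ) (𝔤 : LieSubalgebra ℂ L) :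
    IsCocycle (restrictCochain 𝔤 φ) := fun A => by
  refine Eq.trans ?_ (hφ fun i => (A i : L))
  unfold ceDifferential
  congr 1
  refine Finset.sum_congr rfl fun i _ => ?_
  congr 1
  refine Finset.sum_congr rfl fun j _ => ?_
  rw [restrictCochain, AlternatingMap.compLinearMap_apply]
  congr 1
  funext k
  simp only [Function.update_apply, Fin.removeNth]
  split_ifs <;> rfl

end PsiDif

end

theorem theorem1p1 :
    -- `D₁ = ad (ln ∂)` and `D₂ = ad (ln x)` are derivations of the associative algebra
    (∀ i A B, PsiDif.D i (A * B) = PsiDif.D i A * B + A * PsiDif.D i B) ∧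
    -- `[D₁, D₂] = ad Q`
    (∀ A, PsiDif.D 0 (PsiDif.D 1 A) - PsiDif.D 1 (PsiDif.D 0 A) = PsiDif.Q * A - A * PsiDif.Q) ∧
    -- `Ψ₃` is a cocycle on `ΨDif(S¹)` that is not cohomologous to zero
    IsCocycle PsiDif.Psi3 ∧ ¬ IsCoboundary PsiDif.Psi3 ∧
    -- `1 ∧ x ∧ ∂` is a cycle of `Dif₁` on which `Ψ₃` does not vanish
    ceBoundary ![PsiDif.oneDif, PsiDif.xDif, PsiDif.dDif] = 0 ∧
    restrictCochain PsiDif.Dif1 PsiDif.Psi3 ![PsiDif.oneDif, PsiDif.xDif, PsiDif.dDif] ≠ 0 ∧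
    -- the restriction of `Ψ₃` to `Dif₁` is not cohomologous to zero
    ¬ IsCoboundary (restrictCochain PsiDif.Dif1 PsiDif.Psi3) ∧
    -- the same on every intermediate Lie algebra (for example, Laurent polynomial coefficients)
    ∀ 𝔤 : LieSubalgebra ℂ PsiDif, PsiDif.Dif1 ≤ 𝔤 →
      IsCocycle (restrictCochain 𝔤 PsiDif.Psi3) ∧ ¬ IsCoboundary (restrictCochain 𝔤 PsiDif.Psi3) := by
  have hΨ : PsiDif.Psi3 ![1, PsiDif.x, PsiDif.d] ≠ 0 := by
    rw [PsiDif.Psi3_one_x_d]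
    norm_num
  refine ⟨PsiDif.D_mul, PsiDif.D_comm, PsiDif.isCocycle_Psi3,
    not_isCoboundary_of_heisenberg _ (PsiDif.one_lie _) (PsiDif.one_lie _) PsiDif.lie_x_d hΨ,
    ceBoundary_heisenberg (Subtype.ext (PsiDif.one_lie _)) (Subtype.ext (PsiDif.one_lie _))
      (Subtype.ext PsiDif.lie_x_d), ?_, PsiDif.not_isCoboundary_restrict le_rfl,
    fun 𝔤 h => ⟨PsiDif.isCocycle_restrict PsiDif.isCocycle_Psi3 𝔤,
      PsiDif.not_isCoboundary_restrict h⟩⟩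
  have e : restrictCochain PsiDif.Dif1 PsiDif.Psi3 ![PsiDif.oneDif, PsiDif.xDif, PsiDif.dDif] =
      PsiDif.Psi3 ![1, PsiDif.x, PsiDif.d] := by
    refine congrArg PsiDif.Psi3 (funext fun i => ?_)
    fin_cases i <;> rfl
  rwa [e]
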